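/- Consider a Gaussian $N$-relay diamond network, $N\ge 1$: at each channel use $t$ the source sends $X_s[t]\in\mathbb C$, relay $i\in\{1,\dots,N\}$ receives $Y_i[t]=h_{is}X_s[t]+Z_i[t]$ and sends $X_i[t]\in\mathbb C$, a causal function of $Y_i[1],\dots,Y_i[t]$, and the destination receives $Y_d[t]=\sum_{i=1}^N h_{id}X_i[t]+Z[t]$. Here $h_{is},h_{id}\in\mathbb C$ are arbitrary fixed channel coefficients, known at all nodes, all $Z_i[t]$ and $Z[t]$ are independent circularly symmetric complex Gaussian variables of mean $0$ and variance $N_0W>0$, and the source and all relays are subject to an average power constraint $P>0$ (over a block of $n$ channel uses and for every message, $\sum_t|X_s[t]|^2\le nP$ and $\sum_t\mathbb E|X_i[t]|^2\le nP$). A rate $R$, in bits per channel use, is achievable by a class of schemes if for every $\varepsilon>0$ and all sufficiently large $n$ there is a block code of length $n$ from this class with at least $2^{nR}$ messages that meets the power constraints and whose error probability, averaged over equiprobable messages, is at most $\varepsilon$. Let $C_{AF}$ be the supremum of the rates achievable with amplify-and-forward at the $N$ relays, i.e. with $X_i[t]=\beta_iY_i[t]$ for all $i$ and $t$, where the constants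 $\beta_i\in\mathbb C$ may be chosen with the code. Let $C_1$ be the capacity provided by routing over the best relay, i.e. the supremum of the rates achievable when only one relay, chosen optimally, is used (with an arbitrary causal relay operation) and the remaining $N-1$ relays are kept silent. Then $$C_{AF}\le C_1+2\log_2 N .$$ -/

import Mathlib

open MeasureTheory ProbabilityTheory Filter
open scoped ENNReal

/-- The circularly symmetric complex Gaussian law `CN(0, v)`: real and imaginary parts are
independent, centred, and have variance `v / 2` each. -/
noncomputable def complexGaussian (v : ℝ) : Measure ℂ :=
  ((gaussianReal 0 (v / 2).toNNReal).prod (gaussianReal 0 (v / 2).toNNReal)).map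
    Complex.measurableEquivRealProd.symm

instance complexGaussian_isProbabilityMeasure (v : ℝ) :
    IsProbabilityMeasure (complexGaussian v) :=
  Measure.isProbabilityMeasure_map Complex.measurableEquivRealProd.symm.measurable.aemeasurable

/-- The parameters of a Gaussian `N`-relay diamond network. -/
structure GaussianDiamond (N : ℕ) where
  /-- `hs i` is the channel coefficient from the source to relay `i`. -/
  hs : Fin N → ℂ
  /-- `hd i` is the channel coefficient from relay `i` to the destination. -/
  hd : Fin N → ℂ
  /-- The average power constraint at every node. -/
  P : ℝ
  /-- The noise has power spectral density `N₀ / 2`. -/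
  N₀ : ℝ
  /-- The bandwidth. -/
  W : ℝ
  P_pos : 0 < P
  N₀_pos : 0 < N₀
  W_pos : 0 < W

/-- A block code with `M` messages and `n` channel uses for a diamond network with `N` relays:
a codebook for the source, a causal map for every relay, and a decoder for the destination. -/
structure DiamondCode (N n M : ℕ) where
  /-- The codeword sent by the source for each message. -/
  enc : Fin M → Fin n → ℂ
  /-- `relay i y t` is what relay `i` sends at time `t` if it receives the sequence `y`. -/
  relay : Fin N → (Fin n → ℂ) → Fin n → ℂ
  relay_measurable : ∀ i, Measurable (relay i)
  relay_causal : ∀ i t (y y' : Fin n → ℂ), (∀ s ≤ t, y s = y' s) → relay i y t = relay i y' t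
  /-- The message estimated by the destination from the sequence that it receives. -/
  dec : (Fin n → ℂ) → Fin M
  dec_measurable : Measurable dec

namespace DiamondCode

variable {N n M : ℕ}

/-- Amplify-and-forward: every relay sends a fixed multiple of what it has just received. -/
def IsAmplifyForward (c : DiamondCode N n M) : Prop :=
  ∃ β : Fin N → ℂ, ∀ i y t, c.relay i y t = β i * y t

/-- All relays outside `Γ` are kept silent. -/
def UsesOnly (c : DiamondCode N n M) (Γ : Finset (Fin N)) : Prop :=
  ∀ i ∉ Γ, ∀ y t, c.relay i y t = 0

end DiamondCode

namespace GaussianDiamond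

variable {N n M : ℕ}

/-- The noise realisations over `n` channel uses: at the relays, and at the destination. -/
abbrev Noise (N n : ℕ) : Type := (Fin N → Fin n → ℂ) × (Fin n → ℂ)

/-- All noise samples are independent `CN(0, N₀ W)`, so that the signal-to-noise ratio of
a unit-gain link at full power is `P / (N₀ W)`. -/
noncomputable def noiseLaw (net : GaussianDiamond N) (n : ℕ) : Measure (Noise N n) :=
  (Measure.pi fun _ : Fin N => Measure.pi fun _ : Fin n => complexGaussian (net.N₀ * net.W)).prod
    (Measure.pi fun _ : Fin n => complexGaussian (net.N₀ * net.W))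

/-- The sequence received by relay `i` when message `w` is sent. -/
def relayReceived (net : GaussianDiamond N) (c : DiamondCode N n M) (w : Fin M)
    (z : Noise N n) (i : Fin N) : Fin n → ℂ :=
  fun t => net.hs i * c.enc w t + z.1 i t

/-- The sequence sent by relay `i` when message `w` is sent. -/
def relaySent (net : GaussianDiamond N) (c : DiamondCode N n M) (w : Fin M)
    (z : Noise N n) (i : Fin N) : Fin n → ℂ :=
  c.relay i (net.relayReceived c w z i)

/-- The sequence received by the destination when message `w` is sent. -/
def destReceived (net : GaussianDiamond N) (c : DiamondCode N n M) (w : Fin M)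
    (z : Noise N n) : Fin n → ℂ :=
  fun t => ∑ i, net.hd i * net.relaySent c w z i t + z.2 t

/-- The average power constraint at the source and at all relays, for every message;
for the relays the power is averaged over the noise as well as over time. -/
def PowerConstraint (net : GaussianDiamond N) (c : DiamondCode N n M) : Prop :=
  ∀ w, ∑ t, ‖c.enc w t‖ ^ 2 ≤ n * net.P ∧
    ∀ i, ∑ t, ∫⁻ z, ‖net.relaySent c w z i t‖ₑ ^ 2 ∂(net.noiseLaw n) ≤ ENNReal.ofReal (n * net.P)

/-- The probability of a decoding error, averaged over equiprobable messages. -/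
noncomputable def errorProb (net : GaussianDiamond N) (c : DiamondCode N n M) : ℝ :=
  (∑ w, (net.noiseLaw n).real {z | c.dec (net.destReceived c w z) ≠ w}) / M

/-- The rate `R` (in bits per channel use, i.e. bits/s/Hz) is achievable by codes from the class
`K`: for all large `n`, some code in `K` of length `n` that meets the power constraints
has at least `2 ^ (n R)` messages and arbitrarily small error probability. -/
def Achievable (net : GaussianDiamond N) (K : ∀ {n M : ℕ}, DiamondCode N n M → Prop)
    (R : ℝ) : Prop :=
  ∀ ε > 0, ∀ᶠ n : ℕ in atTop, ∃ (M : ℕ) (c : DiamondCode N n M),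
    (2 : ℝ) ^ (n * R) ≤ M ∧ K c ∧ net.PowerConstraint c ∧ net.errorProb c ≤ ε

/-- `C_AF`: the supremum of the rates achievable with amplify-and-forward at the relays. -/
noncomputable def rateAF (net : GaussianDiamond N) : EReal :=
  sSup {r | ∃ R : ℝ, r = R ∧ net.Achievable (fun c => c.IsAmplifyForward) R}

/-- `C_k`: the supremum of the rates achievable (by arbitrary relay operations) with
only `k` of the relays, the others being silent. -/
noncomputable def capacityUsing (net : GaussianDiamond N) (k : ℕ) : EReal :=
  sSup {r | ∃ R : ℝ, r = R ∧
    ∃ Γ : Finset (Fin N), Γ.card = k ∧ net.Achievable (fun c => c.UsesOnly Γ) R}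

end GaussianDiamond

/-! With amplify-and-forward the diamond is a Gaussian channel with effective noise variance v = N₀W
(1 + ∑ |h_id β_i|²) / |g|², where g = ∑ h_id β_i h_is (`measureReal_error_eq_gaussianVector`). The
strongest of the N paths has gain at least |g| / N, and using it alone removes the noise of the
other relays. Its effective noise variance is therefore at most N² v, and a reduction of the relay
gain makes it exactly N² v (`exists_relay_gain`). It remains to see that raising the noise by a
factor K = N² costs at most log K = 2 log N per channel use.

No formula for the Gaussian capacity enters. A reliable amplify-and-forward code of length n is
itself taken as a finite constellation of vectors in ℂⁿ. Fano's inequality bounds its information at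
noise level v from below. Passing to level K v, the output entropy does not decrease, while the
noise entropy grows by exactly n log K. So the mutual information drops by at most n log K
(`sum_integral_infoDensity_ge`).

Feinstein's lemma and Chebyshev's inequality turn this mutual information into reliable codes whose
letters are the old codewords (`eventually_exists_block_code`, `eventually_exists_gaussian_code`).
These codes need no more power than the old one, and the relay gain is no larger than before, so the
power constraints are inherited. `achievable_of_achievable_amplifyForward` combines these facts,
with an arbitrarily small loss δ of rate; the single relay again amplifies and forwards. -/

/-! ### Laws of sums and linear images of complex Gaussian vectors, by characteristic functions. -/

/-- The law of `n` independent `CN(0, v)` samples. -/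
noncomputable def gaussianVector (v : ℝ) (n : ℕ) : Measure (Fin n → ℂ) :=
  Measure.pi fun _ => complexGaussian v

instance gaussianVector_isProbabilityMeasure (v : ℝ) (n : ℕ) :
    IsProbabilityMeasure (gaussianVector v n) := by
  unfold gaussianVector; infer_instance

lemma charFun_complexGaussian {v : ℝ} (hv : 0 ≤ v) (t : ℂ) :
    charFun (complexGaussian v) t = Complex.exp (-(v * ‖t‖ ^ 2 / 4 : ℝ)) := by
  have key : ∀ s : ℝ,
      ∫ x, Complex.exp ((s * x : ℝ) * Complex.I) ∂(gaussianReal 0 (v / 2).toNNReal)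
        = Complex.exp (-(v * s ^ 2 / 4 : ℝ)) := by
    intro s
    have := charFun_gaussianReal (μ := 0) (v := (v / 2).toNNReal) s
    rw [charFun_apply_real] at this
    push_cast at this ⊢
    rw [this, Real.coe_toNNReal _ (by positivity)]
    congr 1
    push_cast
    ring
  rw [charFun_apply, complexGaussian, integral_map (by fun_prop) (by fun_prop)]
  have : ∀ p : ℝ × ℝ,
      Complex.exp ((inner ℝ (Complex.measurableEquivRealProd.symm p) t : ℝ) * Complex.I)
      = Complex.exp ((t.re * p.1 : ℝ) * Complex.I) *
        Complex.exp ((t.im * p.2 : ℝ) * Complex.I) := by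
    intro p
    rw [← Complex.exp_add]
    congr 1
    simp [Complex.inner, Complex.measurableEquivRealProd]
    ring
  simp_rw [this]
  rw [integral_prod_mul (f := fun x : ℝ => Complex.exp ((t.re * x : ℝ) * Complex.I))
    (g := fun x : ℝ => Complex.exp ((t.im * x : ℝ) * Complex.I)), key, key, ← Complex.exp_add]
  congr 1
  rw [← Complex.normSq_eq_norm_sq, Complex.normSq_apply]
  push_cast
  ring

lemma charFunDual_complexGaussian {v : ℝ} (hv : 0 ≤ v) (L : StrongDual ℝ ℂ) :
    charFunDual (complexGaussian v) L = Complex.exp (-(v * ‖L‖ ^ 2 / 4 : ℝ)) := by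
  rw [← charFun_toDual_symm_eq_charFunDual, charFun_complexGaussian hv]
  simp

/-- The exponent is linear in `v` and quadratic in `L`, so the laws of sums and of linear images of
Gaussian vectors can be read off from it. -/
lemma charFunDual_gaussianVector {v : ℝ} (hv : 0 ≤ v) {n : ℕ} (L : StrongDual ℝ (Fin n → ℂ)) :
    charFunDual (gaussianVector v n) L
      = Complex.exp (-(v * ∑ t, ‖L.comp (.single ℝ (fun _ => ℂ) t)‖ ^ 2 / 4 : ℝ)) := by
  rw [gaussianVector, charFunDual_pi]
  simp_rw [charFunDual_complexGaussian hv]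
  rw [← Complex.exp_sum]
  congr 1
  push_cast
  rw [Finset.sum_neg_distrib, Finset.mul_sum]
  simp_rw [mul_div_assoc]

lemma gaussianVector_conv {v w : ℝ} (hv : 0 ≤ v) (hw : 0 ≤ w) (n : ℕ) :
    (gaussianVector v n).conv (gaussianVector w n) = gaussianVector (v + w) n := by
  apply Measure.ext_of_charFunDual
  ext L
  rw [charFunDual_conv, charFunDual_gaussianVector hv, charFunDual_gaussianVector hw,
    charFunDual_gaussianVector (add_nonneg hv hw), ← Complex.exp_add]
  congr 1
  push_cast
  ring

/-- Multiplication by `a` is a rotation followed by a scaling by |a|. This is how circular symmetry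
enters: phases of channel coefficients do not affect the noise law. -/
lemma norm_dual_comp_mul (L : StrongDual ℝ ℂ) (a : ℂ) :
    ‖L.comp (ContinuousLinearMap.mul ℝ ℂ a)‖ = ‖a‖ * ‖L‖ := by
  apply le_antisymm
  · refine (ContinuousLinearMap.opNorm_comp_le _ _).trans ?_
    rw [mul_comm]
    gcongr
    exact ContinuousLinearMap.opNorm_mul_apply_le ℝ ℂ a
  · rcases eq_or_ne a 0 with rfl | ha
    · simp
    rw [mul_comm, ← le_div_iff₀ (norm_pos_iff.2 ha)]
    refine L.opNorm_le_bound (by positivity) fun x => ?_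
    have := (L.comp (ContinuousLinearMap.mul ℝ ℂ a)).le_opNorm (a⁻¹ * x)
    simp only [ContinuousLinearMap.coe_comp, Function.comp_apply,
      ContinuousLinearMap.mul_apply', mul_inv_cancel_left₀ ha, norm_mul, norm_inv] at this
    refine this.trans (le_of_eq ?_)
    ring

/-- The map that combines the noise at the relays and at the destination, if relay `i` has total
gain `a i` to the destination. -/
noncomputable def combineNoise {N : ℕ} (a : Fin N → ℂ) (n : ℕ) :
    GaussianDiamond.Noise N n →L[ℝ] (Fin n → ℂ) :=
  ContinuousLinearMap.pi fun t =>
    (∑ i, (ContinuousLinearMap.mul ℝ ℂ (a i)).comp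
      (((ContinuousLinearMap.proj t).comp (ContinuousLinearMap.proj i)).comp
        (ContinuousLinearMap.fst ℝ (Fin N → Fin n → ℂ) (Fin n → ℂ)))) +
    (ContinuousLinearMap.proj t).comp
        (ContinuousLinearMap.snd ℝ (Fin N → Fin n → ℂ) (Fin n → ℂ))

lemma combineNoise_apply {N n : ℕ} (a : Fin N → ℂ) (z : GaussianDiamond.Noise N n) (t : Fin n) :
    combineNoise a n z t = ∑ i, a i * z.1 i t + z.2 t := by
  simp [combineNoise]

instance {N : ℕ} (net : GaussianDiamond N) (n : ℕ) : IsProbabilityMeasure (net.noiseLaw n) := by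
  unfold GaussianDiamond.noiseLaw; infer_instance

/-- Independent Gaussian contributions add their variances: relay `i` contributes |a_i|² N₀W, the
destination N₀W. -/
lemma noiseLaw_map_combineNoise {N : ℕ} (net : GaussianDiamond N) (a : Fin N → ℂ) (n : ℕ) :
    (net.noiseLaw n).map (combineNoise a n)
      = gaussianVector (net.N₀ * net.W * (1 + ∑ i, ‖a i‖ ^ 2)) n := by
  have hσ : 0 ≤ net.N₀ * net.W := (mul_pos net.N₀_pos net.W_pos).le
  apply Measure.ext_of_charFunDual
  ext L
  change charFunDual ((Measure.map (combineNoise a n)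
    ((Measure.pi fun _ : Fin N => gaussianVector (net.N₀ * net.W) n).prod
      (gaussianVector (net.N₀ * net.W) n)))) L = _
  rw [charFunDual_map, charFunDual_prod, charFunDual_pi,
    charFunDual_gaussianVector (mul_nonneg hσ (by positivity))]
  simp_rw [charFunDual_gaussianVector hσ]
  have h1 : ∀ (i : Fin N) (t : Fin n), (((((L.comp (combineNoise a n)).comp
      (ContinuousLinearMap.inl ℝ (Fin N → Fin n → ℂ) (Fin n → ℂ))).comp
      (.single ℝ (fun _ => Fin n → ℂ) i))).comp (.single ℝ (fun _ => ℂ) t))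
      = (L.comp (.single ℝ (fun _ => ℂ) t)).comp (ContinuousLinearMap.mul ℝ ℂ (a i)) := by
    intro i t
    ext x
    · simp only [ContinuousLinearMap.coe_comp, Function.comp_apply]
      congr 1
      ext s
      rw [combineNoise_apply]
      simp [Pi.single_apply, ite_apply]
  have h2 : ∀ t : Fin n, (((L.comp (combineNoise a n)).comp
      (ContinuousLinearMap.inr ℝ (Fin N → Fin n → ℂ) (Fin n → ℂ)))).comp
      (.single ℝ (fun _ => ℂ) t) = L.comp (.single ℝ (fun _ => ℂ) t) := by
    intro t
    ext x
    · simp only [ContinuousLinearMap.coe_comp, Function.comp_apply]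
      congr 1
      ext s
      rw [combineNoise_apply]
      simp
  simp_rw [h1, h2, norm_dual_comp_mul]
  rw [← Complex.exp_sum, ← Complex.exp_add]
  congr 1
  rw [Finset.sum_neg_distrib, ← neg_add, ← Complex.ofReal_sum, ← Complex.ofReal_add]
  congr 2
  simp_rw [mul_pow, ← Finset.mul_sum]
  simp_rw [← Finset.sum_div, ← Finset.mul_sum, ← Finset.sum_mul]
  ring

lemma gaussianVector_map_mul {v : ℝ} (hv : 0 ≤ v) (n : ℕ) (a : ℂ) :
    (gaussianVector v n).map (fun z t => a * z t) = gaussianVector (‖a‖ ^ 2 * v) n := by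
  have : (fun (z : Fin n → ℂ) t => a * z t) = (ContinuousLinearMap.pi fun t =>
      (ContinuousLinearMap.mul ℝ ℂ a).comp (ContinuousLinearMap.proj (R := ℝ) (φ := fun _ => ℂ) t) :
        (Fin n → ℂ) →L[ℝ] (Fin n → ℂ)) := by
    ext z t
    simp
  rw [this]
  apply Measure.ext_of_charFunDual
  ext L
  rw [charFunDual_map, charFunDual_gaussianVector hv,
    charFunDual_gaussianVector (mul_nonneg (by positivity) hv)]
  have h1 : ∀ t : Fin n, (L.comp (ContinuousLinearMap.pi fun t =>
      (ContinuousLinearMap.mul ℝ ℂ a).comp (ContinuousLinearMap.proj (R := ℝ) (φ := fun _ => ℂ) t) :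
        (Fin n → ℂ) →L[ℝ] (Fin n → ℂ))).comp
      (.single ℝ (fun _ => ℂ) t)
      = (L.comp (.single ℝ (fun _ => ℂ) t)).comp (ContinuousLinearMap.mul ℝ ℂ a) := by
    intro t
    ext x
    · simp only [ContinuousLinearMap.coe_comp, Function.comp_apply]
      congr 1
      ext s
      simp [Pi.single_apply]
  simp_rw [h1, norm_dual_comp_mul, mul_pow]
  rw [Finset.mul_sum, Finset.mul_sum]
  congr 3
  refine Finset.sum_congr rfl fun t _ => ?_
  ring

/-! ### Densities, moments and entropy of Gaussian vectors. -/

/-- The probability density of `gaussianVector v n`. -/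
noncomputable def gaussianDensity (v : ℝ) {n : ℕ} (z : Fin n → ℂ) : ℝ :=
  ((Real.pi * v)⁻¹) ^ n * Real.exp (-(∑ t, ‖z t‖ ^ 2) / v)

lemma gaussianDensity_pos {v : ℝ} (hv : 0 < v) {n : ℕ} (z : Fin n → ℂ) :
    0 < gaussianDensity v z := by
  unfold gaussianDensity; positivity

lemma measurable_gaussianDensity (v : ℝ) (n : ℕ) :
    Measurable (gaussianDensity v : (Fin n → ℂ) → ℝ) := by
  unfold gaussianDensity; fun_prop

lemma complexGaussian_eq_withDensity {v : ℝ} (hv : 0 < v) :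
    complexGaussian v = volume.withDensity
      fun z : ℂ => ENNReal.ofReal ((Real.pi * v)⁻¹ * Real.exp (-‖z‖ ^ 2 / v)) := by
  have hv' : (v / 2).toNNReal ≠ 0 := by simpa using hv
  rw [complexGaussian, gaussianReal_of_var_ne_zero _ hv',
    prod_withDensity (measurable_gaussianPDF _ _) (measurable_gaussianPDF _ _)]
  have hmp := Complex.volume_preserving_equiv_real_prod.symm
  ext s hs
  rw [Measure.map_apply (by fun_prop) hs, withDensity_apply _ hs,
    withDensity_apply _ (hs.preimage (by fun_prop)),
    ← hmp.setLIntegral_comp_preimage hs (by fun_prop)]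
  refine lintegral_congr fun p => ?_
  rw [gaussianPDF, gaussianPDF, ← ENNReal.ofReal_mul (gaussianPDFReal_nonneg _ _ _)]
  congr 1
  rw [gaussianPDFReal, gaussianPDFReal, Real.coe_toNNReal _ (by positivity),
    ← Complex.normSq_eq_norm_sq, Complex.normSq_apply]
  simp only [Complex.measurableEquivRealProd_symm_apply, sub_zero]
  rw [mul_mul_mul_comm, ← Real.exp_add, ← mul_inv, Real.mul_self_sqrt (by positivity)]
  congr 2
  · field_simp
  · field_simp
    ring

lemma gaussianVector_eq_withDensity {v : ℝ} (hv : 0 < v) (n : ℕ) :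
    gaussianVector v n = volume.withDensity fun z => ENNReal.ofReal (gaussianDensity v z) := by
  refine Measure.pi_eq fun s hs => ?_
  have hp : ∀ z : ℂ, 0 ≤ (Real.pi * v)⁻¹ * Real.exp (-‖z‖ ^ 2 / v) := fun z => by positivity
  have hint : ∀ s : Set ℂ, MeasurableSet s →
      ∫⁻ z in s, ENNReal.ofReal ((Real.pi * v)⁻¹ * Real.exp (-‖z‖ ^ 2 / v)) =
      complexGaussian v s := fun s hs => by
    rw [complexGaussian_eq_withDensity hv, withDensity_apply _ hs]
  have hI : ∀ s : Set ℂ, MeasurableSet s →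
      Integrable (fun z : ℂ => (Real.pi * v)⁻¹ * Real.exp (-‖z‖ ^ 2 / v)) (volume.restrict s) := by
    intro s hs
    refine ⟨by fun_prop, ?_⟩
    rw [hasFiniteIntegral_iff_ofReal (.of_forall hp), hint s hs]
    exact measure_lt_top _ _
  have hD : ∀ z : Fin n → ℂ, gaussianDensity v z
      = ∏ t, ((Real.pi * v)⁻¹ * Real.exp (-‖z t‖ ^ 2 / v)) := by
    intro z
    rw [Finset.prod_mul_distrib, ← Real.exp_sum, gaussianDensity, ← Finset.sum_div,
      Finset.sum_neg_distrib]
    simp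
  rw [withDensity_apply _ (.univ_pi hs), volume_pi, Measure.restrict_pi_pi]
  simp_rw [hD]
  rw [← ofReal_integral_eq_lintegral_ofReal
      (Integrable.fintype_prod (f := fun _ (z : ℂ) => (Real.pi * v)⁻¹ * Real.exp (-‖z‖ ^ 2 / v))
        (fun t => hI _ (hs t)))
      (.of_forall fun z => Finset.prod_nonneg fun t _ => hp _),
    integral_fintype_prod_eq_prod (fun _ (z : ℂ) => (Real.pi * v)⁻¹ * Real.exp (-‖z‖ ^ 2 / v)),
    ENNReal.ofReal_prod_of_nonneg (fun t _ => integral_nonneg hp)]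
  refine Finset.prod_congr rfl fun t _ => ?_
  rw [ofReal_integral_eq_lintegral_ofReal (hI _ (hs t)) (.of_forall hp), hint _ (hs t)]

lemma integral_gaussianVector {v : ℝ} (hv : 0 < v) {n : ℕ} (f : (Fin n → ℂ) → ℝ) :
    ∫ z, f z ∂(gaussianVector v n) = ∫ z, gaussianDensity v z * f z := by
  rw [gaussianVector_eq_withDensity hv, integral_withDensity_eq_integral_toReal_smul
    (measurable_gaussianDensity v n).ennreal_ofReal (.of_forall fun _ => ENNReal.ofReal_lt_top)]
  simp_rw [ENNReal.toReal_ofReal (gaussianDensity_pos hv _).le, smul_eq_mul]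

lemma integrable_gaussianVector_iff {v : ℝ} (hv : 0 < v) {n : ℕ} (f : (Fin n → ℂ) → ℝ) :
    Integrable f (gaussianVector v n) ↔ Integrable fun z => gaussianDensity v z * f z := by
  rw [gaussianVector_eq_withDensity hv, integrable_withDensity_iff_integrable_smul'
    (measurable_gaussianDensity v n).ennreal_ofReal (.of_forall fun _ => ENNReal.ofReal_lt_top)]
  simp_rw [ENNReal.toReal_ofReal (gaussianDensity_pos hv _).le, smul_eq_mul]

/-- A fourth moment bound; through `memLp_infoDensity` it gives the finite variance that Chebyshev's
inequality needs. -/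
lemma memLp_norm_sq_complexGaussian (v : ℝ) :
    MemLp (fun z : ℂ => ‖z‖ ^ 2) 2 (complexGaussian v) := by
  have hsq : MemLp (fun x : ℝ => x ^ 2) 2 (gaussianReal 0 (v / 2).toNNReal) := by
    have := (memLp_id_gaussianReal (μ := 0) (v := (v / 2).toNNReal) 4).norm_rpow_div (q := 2)
    have h : ((4 : NNReal) : ℝ≥0∞) / 2 = 2 := by
      rw [eq_comm, ENNReal.eq_div_iff (by norm_num) (by norm_num)]
      norm_num
    rw [h] at this
    simpa using this
  rw [complexGaussian, memLp_map_measure_iff (by fun_prop) (by fun_prop)]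
  have : (fun z : ℂ => ‖z‖ ^ 2) ∘ Complex.measurableEquivRealProd.symm
      = fun p : ℝ × ℝ => p.1 ^ 2 + p.2 ^ 2 := by
    ext p
    simp only [Function.comp_apply, Complex.measurableEquivRealProd_symm_apply,
      ← Complex.normSq_eq_norm_sq, Complex.normSq_apply]
    ring
  rw [this]
  exact (hsq.comp_fst _).add (hsq.comp_snd _)

lemma memLp_sum_norm_sq_gaussianVector (v : ℝ) (n : ℕ) :
    MemLp (fun z : Fin n → ℂ => ∑ t, ‖z t‖ ^ 2) 2 (gaussianVector v n) :=
  memLp_finsetSum _ fun t _ =>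
    (memLp_norm_sq_complexGaussian v).comp_measurePreserving
      (measurePreserving_eval (fun _ : Fin n => complexGaussian v) t)

lemma integral_norm_add_sq_complexGaussian {v : ℝ} (hv : 0 ≤ v) (a : ℂ) :
    ∫⁻ z, ‖a + z‖ₑ ^ 2 ∂(complexGaussian v) = ENNReal.ofReal (‖a‖ ^ 2 + v) := by
  have hm : MemLp (fun x : ℝ => x) 2 (gaussianReal 0 (v / 2).toNNReal) :=
    memLp_id_gaussianReal 2
  have key : ∀ b : ℝ, ∫ x, (b + x) ^ 2 ∂(gaussianReal 0 (v / 2).toNNReal) = b ^ 2 + v / 2 := by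
    intro b
    have h0 : ∫ x, x ∂(gaussianReal 0 (v / 2).toNNReal) = 0 := integral_id_gaussianReal
    have h2 : ∫ x, x ^ 2 ∂(gaussianReal 0 (v / 2).toNNReal) = v / 2 := by
      have := variance_id_gaussianReal (μ := 0) (v := (v / 2).toNNReal)
      rw [variance_eq_sub (memLp_id_gaussianReal 2)] at this
      simpa [h0, max_eq_left (show 0 ≤ v / 2 by positivity)] using this
    have h1 : Integrable (fun x : ℝ => x) (gaussianReal 0 (v / 2).toNNReal) :=
      hm.integrable (by norm_num)
    simp_rw [add_sq]
    have h3 : Integrable (fun x : ℝ => b ^ 2 + 2 * b * x) (gaussianReal 0 (v / 2).toNNReal) :=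
      (integrable_const _).add (h1.const_mul _)
    rw [integral_add h3 hm.integrable_sq,
      integral_add (integrable_const _) (h1.const_mul _), integral_const_mul, h0, h2]
    simp
  have hk : ∀ b : ℝ, Integrable (fun x => (b + x) ^ 2) (gaussianReal 0 (v / 2).toNNReal) :=
    fun b => ((memLp_const b).add hm).integrable_sq
  rw [complexGaussian, lintegral_map (by fun_prop) (by fun_prop)]
  have : ∀ p : ℝ × ℝ, ‖a + Complex.measurableEquivRealProd.symm p‖ₑ ^ 2
      = ENNReal.ofReal ((a.re + p.1) ^ 2 + (a.im + p.2) ^ 2) := by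
    intro p
    rw [← ofReal_norm, ← ENNReal.ofReal_pow (norm_nonneg _), ← Complex.normSq_eq_norm_sq,
      Complex.normSq_apply]
    congr 1
    simp only [Complex.measurableEquivRealProd_symm_apply, Complex.add_re, Complex.add_im]
    ring
  simp_rw [this]
  have i1 : Integrable (fun p : ℝ × ℝ => (a.re + p.1) ^ 2)
    ((gaussianReal 0 (v / 2).toNNReal).prod (gaussianReal 0 (v / 2).toNNReal)) :=
      (hk a.re).comp_fst _
  have i2 : Integrable (fun p : ℝ × ℝ => (a.im + p.2) ^ 2)
    ((gaussianReal 0 (v / 2).toNNReal).prod (gaussianReal 0 (v / 2).toNNReal)) :=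
      (hk a.im).comp_snd _
  rw [← ofReal_integral_eq_lintegral_ofReal (f := fun p : ℝ × ℝ => (a.re + p.1) ^ 2 +
      (a.im + p.2) ^ 2) (i1.add i2) (.of_forall fun p => by positivity), integral_add i1 i2,
    integral_fun_fst (f := fun x => (a.re + x) ^ 2),
    integral_fun_snd (f := fun x => (a.im + x) ^ 2), key, key,
    ← Complex.normSq_eq_norm_sq, Complex.normSq_apply]
  congr 1
  simp
  ring

lemma integral_sum_norm_sq_gaussianVector {v : ℝ} (hv : 0 ≤ v) (n : ℕ) :
    ∫ z, ∑ t, ‖z t‖ ^ 2 ∂(gaussianVector v n) = n * v := by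
  have h1 : ∫ z, ‖z‖ ^ 2 ∂(complexGaussian v) = v := by
    rw [integral_eq_lintegral_of_nonneg_ae (.of_forall fun z => by positivity) (by fun_prop)]
    have := integral_norm_add_sq_complexGaussian hv 0
    simp only [zero_add, norm_zero] at this
    simp_rw [ENNReal.ofReal_pow (norm_nonneg _), ofReal_norm, this]
    rw [ENNReal.toReal_ofReal (by positivity)]
    ring
  rw [integral_finsetSum _ fun t _ => ?_]
  · have : ∀ t : Fin n, ∫ z, ‖z t‖ ^ 2 ∂(gaussianVector v n) = v := fun t => by
      rw [gaussianVector, integral_comp_eval (μ := fun _ : Fin n => complexGaussian v) (i := t)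
        (f := fun z : ℂ => ‖z‖ ^ 2) (by fun_prop), h1]
    simp [this]
  · exact ((memLp_norm_sq_complexGaussian v).comp_measurePreserving
      (measurePreserving_eval (fun _ : Fin n => complexGaussian v) t)).integrable (by norm_num)

lemma integrable_sum_norm_sq_gaussianVector (v : ℝ) (n : ℕ) :
    Integrable (fun z : Fin n → ℂ => ∑ t, ‖z t‖ ^ 2) (gaussianVector v n) :=
  (memLp_sum_norm_sq_gaussianVector v n).integrable (by norm_num)

lemma log_gaussianDensity {v : ℝ} (hv : 0 < v) {n : ℕ} (z : Fin n → ℂ) :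
    Real.log (gaussianDensity v z) = -(n * Real.log (Real.pi * v)) - (∑ t, ‖z t‖ ^ 2) / v := by
  rw [gaussianDensity, Real.log_mul (by positivity) (by positivity), Real.log_exp, Real.log_pow,
    Real.log_inv]
  ring

lemma integrable_log_gaussianDensity {v : ℝ} (hv : 0 < v) (n : ℕ) :
    Integrable (fun z : Fin n → ℂ => Real.log (gaussianDensity v z)) (gaussianVector v n) := by
  simp_rw [log_gaussianDensity hv]
  exact (integrable_const _).sub ((integrable_sum_norm_sq_gaussianVector v n).div_const v)

/-- This is minus the differential entropy; scaling `v` by K changes it by n log K. -/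
lemma integral_log_gaussianDensity {v : ℝ} (hv : 0 < v) (n : ℕ) :
    ∫ z : Fin n → ℂ, Real.log (gaussianDensity v z) ∂(gaussianVector v n)
      = -(n * (Real.log (Real.pi * v) + 1)) := by
  simp_rw [log_gaussianDensity hv]
  rw [integral_sub (integrable_const _) ((integrable_sum_norm_sq_gaussianVector v n).div_const v),
    integral_div, integral_sum_norm_sq_gaussianVector hv.le]
  simp
  field_simp
  ring

lemma integrable_gaussianDensity {v : ℝ} (hv : 0 < v) (n : ℕ) :
    Integrable (gaussianDensity v : (Fin n → ℂ) → ℝ) := by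
  simpa using (integrable_gaussianVector_iff hv (fun _ : Fin n → ℂ => (1 : ℝ))).1
    (integrable_const _)

lemma integral_gaussianDensity {v : ℝ} (hv : 0 < v) (n : ℕ) :
    ∫ z : Fin n → ℂ, gaussianDensity v z = 1 := by
  simpa using (integral_gaussianVector hv (fun _ : Fin n → ℂ => (1 : ℝ))).symm

/-! ### The information density of a finite constellation in Gaussian noise. -/

section Mixture

variable {A : Type*} [Fintype A] {n : ℕ}

/-- The density of the output of a Gaussian vector channel with uniformly distributed input. -/
noncomputable def mixtureDensity (v : ℝ) (x : A → Fin n → ℂ) (y : Fin n → ℂ) : ℝ :=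
  (∑ w, gaussianDensity v (y - x w)) / Fintype.card A

/-- The information density between the input and the output of a Gaussian vector channel
with uniformly distributed input. -/
noncomputable def infoDensity (v : ℝ) (x : A → Fin n → ℂ) (w : A) (y : Fin n → ℂ) : ℝ :=
  Real.log (gaussianDensity v (y - x w)) - Real.log (mixtureDensity v x y)

lemma measurable_mixtureDensity (v : ℝ) (x : A → Fin n → ℂ) : Measurable (mixtureDensity v x) :=
  (Finset.measurable_sum _ fun w _ =>
    (measurable_gaussianDensity v n).comp (measurable_id.sub_const (x w))).div_const _

lemma measurable_infoDensity (v : ℝ) (x : A → Fin n → ℂ) (w : A) :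
    Measurable (infoDensity v x w) :=
  (((measurable_gaussianDensity v n).comp (measurable_id.sub_const (x w))).log).sub
    (measurable_mixtureDensity v x).log

lemma integrable_mixtureDensity {v : ℝ} (hv : 0 < v) (x : A → Fin n → ℂ) :
    Integrable (mixtureDensity v x) :=
  (integrable_finsetSum _ fun w _ =>
    (integrable_gaussianDensity hv n).comp_sub_right (x w)).div_const _

variable [Nonempty A]

lemma mixtureDensity_pos {v : ℝ} (hv : 0 < v) (x : A → Fin n → ℂ) (y : Fin n → ℂ) :
    0 < mixtureDensity v x y :=
  div_pos (Finset.sum_pos (fun _ _ => gaussianDensity_pos hv _) Finset.univ_nonempty)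
    (by exact_mod_cast Fintype.card_pos)

lemma gaussianDensity_le_mixtureDensity {v : ℝ} (hv : 0 < v) (x : A → Fin n → ℂ) (w : A)
    (y : Fin n → ℂ) : gaussianDensity v (y - x w) ≤ Fintype.card A * mixtureDensity v x y := by
  rw [mixtureDensity, mul_div_cancel₀ _ (by exact_mod_cast Fintype.card_ne_zero)]
  exact Finset.single_le_sum (f := fun w => gaussianDensity v (y - x w))
    (fun w _ => (gaussianDensity_pos hv _).le) (Finset.mem_univ w)

lemma mixtureDensity_le {v : ℝ} (hv : 0 < v) (x : A → Fin n → ℂ) (y : Fin n → ℂ) :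
    mixtureDensity v x y ≤ ((Real.pi * v)⁻¹) ^ n := by
  rw [mixtureDensity, div_le_iff₀ (by exact_mod_cast Fintype.card_pos)]
  calc _ ≤ ∑ _w : A, ((Real.pi * v)⁻¹) ^ n := by
        refine Finset.sum_le_sum fun w _ => ?_
        rw [gaussianDensity]
        refine mul_le_of_le_one_right (by positivity) (Real.exp_le_one_iff.2 ?_)
        rw [neg_div, neg_nonpos]
        positivity
    _ = _ := by simp [mul_comm]

lemma integral_mixtureDensity {v : ℝ} (hv : 0 < v) (x : A → Fin n → ℂ) :
    ∫ y, mixtureDensity v x y = 1 := by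
  simp_rw [mixtureDensity]
  rw [integral_div, integral_finsetSum _ fun w _ =>
    (integrable_gaussianDensity hv n).comp_sub_right (x w)]
  simp_rw [integral_sub_right_eq_self (fun y => gaussianDensity v y), integral_gaussianDensity hv]
  simp

lemma log_mixtureDensity_le {v : ℝ} (hv : 0 < v) (x : A → Fin n → ℂ) (y : Fin n → ℂ) :
    Real.log (mixtureDensity v x y) ≤ -(n * Real.log (Real.pi * v)) := by
  refine (Real.log_le_log (mixtureDensity_pos hv x y) (mixtureDensity_le hv x y)).trans_eq ?_
  rw [Real.log_pow, Real.log_inv]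
  ring

/-- The term of `w` is itself one of the summands of the mixture, with weight `1 / Fintype.card A`.
-/
lemma infoDensity_le {v : ℝ} (hv : 0 < v) (x : A → Fin n → ℂ) (w : A) (y : Fin n → ℂ) :
    infoDensity v x w y ≤ Real.log (Fintype.card A) := by
  have := Real.log_le_log (gaussianDensity_pos hv _) (gaussianDensity_le_mixtureDensity hv x w y)
  rw [Real.log_mul (by exact_mod_cast Fintype.card_ne_zero) (mixtureDensity_pos hv x y).ne'] at this
  rw [infoDensity]
  linarith

/-- The mixture never exceeds the peak of the Gaussian density, so the normalising constants cancel.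
-/
lemma neg_le_infoDensity {v : ℝ} (hv : 0 < v) (x : A → Fin n → ℂ) (w : A) (y : Fin n → ℂ) :
    -((∑ t, ‖y t - x w t‖ ^ 2) / v) ≤ infoDensity v x w y := by
  have := log_mixtureDensity_le hv x y
  rw [infoDensity, log_gaussianDensity hv]
  simp only [Pi.sub_apply]
  linarith

lemma abs_infoDensity_le {v : ℝ} (hv : 0 < v) (x : A → Fin n → ℂ) (w : A) (z : Fin n → ℂ) :
    |infoDensity v x w (x w + z)| ≤ Real.log (Fintype.card A) + (∑ t, ‖z t‖ ^ 2) / v := by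
  have h1 := infoDensity_le hv x w (x w + z)
  have h2 := neg_le_infoDensity hv x w (x w + z)
  simp only [Pi.add_apply, add_sub_cancel_left] at h2
  have h3 : 0 ≤ (∑ t, ‖z t‖ ^ 2) / v := by positivity
  have h4 : 0 ≤ Real.log (Fintype.card A) := Real.log_natCast_nonneg _
  rw [abs_le]
  constructor <;> linarith

lemma memLp_infoDensity {v : ℝ} (hv : 0 < v) (x : A → Fin n → ℂ) (w : A) :
    MemLp (fun z => infoDensity v x w (x w + z)) 2 (gaussianVector v n) := by
  refine ((memLp_const (Real.log (Fintype.card A))).add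
    ((memLp_sum_norm_sq_gaussianVector v n).mul_const v⁻¹)).mono
    ((measurable_infoDensity v x w).comp (measurable_const_add (x w))).aestronglyMeasurable
    (.of_forall fun z => ?_)
  rw [Real.norm_eq_abs, Real.norm_eq_abs]
  exact (abs_infoDensity_le hv x w z).trans (le_abs_self _)

lemma exp_infoDensity {v : ℝ} (hv : 0 < v) (x : A → Fin n → ℂ) (w : A) (y : Fin n → ℂ) :
    Real.exp (infoDensity v x w y) = gaussianDensity v (y - x w) / mixtureDensity v x y := by
  rw [infoDensity, Real.exp_sub, Real.exp_log (gaussianDensity_pos hv _),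
    Real.exp_log (mixtureDensity_pos hv x y)]

lemma integrable_exp_infoDensity {v : ℝ} (hv : 0 < v) (x : A → Fin n → ℂ) (w w' : A) :
    Integrable (fun z => Real.exp (infoDensity v x w (x w' + z))) (gaussianVector v n) := by
  refine Integrable.of_bound ((measurable_infoDensity v x w).comp
    (measurable_const_add (x w'))).exp.aestronglyMeasurable
    (Real.exp (Real.log (Fintype.card A))) (.of_forall fun z => ?_)
  rw [Real.norm_eq_abs, abs_of_pos (Real.exp_pos _)]
  exact Real.exp_le_exp.2 (infoDensity_le hv x w _)

/-- Summing over the true input `w'` produces the output density, which cancels the denominator of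
the exponentiated information density. So its mean is one when the output is independent of the
tested word, as the union bound in Feinstein's lemma requires. -/
lemma sum_integral_exp_infoDensity {v : ℝ} (hv : 0 < v) (x : A → Fin n → ℂ) (w : A) :
    ∑ w', ∫ z, Real.exp (infoDensity v x w (x w' + z)) ∂(gaussianVector v n) = Fintype.card A := by
  have h1 : ∀ w', ∫ z, Real.exp (infoDensity v x w (x w' + z)) ∂(gaussianVector v n)
      = ∫ y, gaussianDensity v (y - x w') * Real.exp (infoDensity v x w y) := by
    intro w'
    rw [integral_gaussianVector hv, ← integral_sub_right_eq_self _ (x w')]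
    simp
  have h2 : ∀ w', Integrable fun y =>
      gaussianDensity v (y - x w') * Real.exp (infoDensity v x w y) := by
    intro w'
    have := ((integrable_gaussianVector_iff hv _).1
      (integrable_exp_infoDensity hv x w w')).comp_sub_right (x w')
    simpa using this
  simp_rw [h1]
  rw [← integral_finsetSum _ fun w' _ => h2 w']
  have h3 : ∀ y, ∑ w', gaussianDensity v (y - x w') * Real.exp (infoDensity v x w y)
      = Fintype.card A * gaussianDensity v (y - x w) := by
    intro y
    have hm := (mixtureDensity_pos hv x y).ne'
    rw [← Finset.sum_mul, exp_infoDensity hv, ← mul_div_assoc, div_eq_iff hm, mixtureDensity]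
    have : (Fintype.card A : ℝ) ≠ 0 := by exact_mod_cast Fintype.card_ne_zero
    field_simp
  simp_rw [h3]
  rw [integral_const_mul, integral_sub_right_eq_self (fun y => gaussianDensity v y),
    integral_gaussianDensity hv, mul_one]

end Mixture

/-! ### Fano's inequality and the effect of additional noise. -/

section Converse

variable {n M : ℕ}

/-- Fano's inequality with an arbitrary density `r` in place of the output density. It is log t ≤ t
− 1 for t = r k / (2 g), where g is the noise density and k is M on correct decoding and 1
otherwise. For each output the k sum to at most 2 M over the messages, so the means of t sum to at
most M. -/
lemma log_mul_sum_le_of_density [NeZero M] {v : ℝ} (hv : 0 < v) (x : Fin M → Fin n → ℂ)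
    {dec : (Fin n → ℂ) → Fin M} (hdec : Measurable dec) {r : (Fin n → ℂ) → ℝ}
    (hr : ∀ y, 0 < r y) (hri : Integrable r) (hr1 : ∫ y, r y = 1)
    (hlog : ∀ w, Integrable (fun z => Real.log (r (x w + z))) (gaussianVector v n)) :
    Real.log M * ∑ w, (gaussianVector v n).real {z | dec (x w + z) = w} - M * Real.log 2
      ≤ ∑ w, ∫ z, (Real.log (gaussianDensity v z) - Real.log (r (x w + z)))
        ∂(gaussianVector v n) := by
  have hM : (0 : ℝ) < M := by exact_mod_cast Nat.pos_of_ne_zero (NeZero.ne M)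
  have hM1 : (1 : ℝ) ≤ M := by exact_mod_cast Nat.one_le_iff_ne_zero.2 (NeZero.ne M)
  let k : Fin M → (Fin n → ℂ) → ℝ := fun w y => if dec y = w then (M : ℝ) else 1
  have hk0 : ∀ w y, 0 < k w y := fun w y => by simp only [k]; split_ifs <;> simp [hM]
  have hkM : ∀ w y, k w y ≤ M := fun w y => by simp only [k]; split_ifs <;> simp [hM1]
  have hkm : ∀ w, Measurable (k w) := fun w =>
    Measurable.ite (hdec (measurableSet_singleton w)) measurable_const measurable_const
  have hksum : ∀ y, ∑ w, k w y ≤ 2 * M := fun y => by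
    calc ∑ w, k w y ≤ ∑ w, ((if dec y = w then (M : ℝ) else 0) + 1) := by
          refine Finset.sum_le_sum fun w _ => ?_
          simp only [k]; split_ifs <;> simp
      _ = 2 * M := by rw [Finset.sum_add_distrib]; simp; ring
  have hrk : ∀ w, Integrable fun y => r y * k w y := fun w =>
    hri.mul_bdd (c := M) (hkm w).aestronglyMeasurable
      (.of_forall fun y => by rw [Real.norm_eq_abs, abs_of_pos (hk0 w y)]; exact hkM w y)
  have hcancel : ∀ w z, gaussianDensity v z *
      (r (x w + z) * k w (x w + z) / (2 * gaussianDensity v z))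
      = (r (x w + z) * k w (x w + z)) / 2 := fun w z => by
    have := (gaussianDensity_pos hv z).ne'
    field_simp
  have hint : ∀ w, ∫ z, r (x w + z) * k w (x w + z) / (2 * gaussianDensity v z)
      ∂(gaussianVector v n) = (∫ y, r y * k w y) / 2 := by
    intro w
    rw [integral_gaussianVector hv]
    simp_rw [hcancel]
    rw [integral_div, integral_add_left_eq_self (fun y => r y * k w y)]
  have hintble : ∀ w, Integrable (fun z => r (x w + z) * k w (x w + z) / (2 * gaussianDensity v z))
      (gaussianVector v n) := by
    intro w
    rw [integrable_gaussianVector_iff hv]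
    simp_rw [hcancel]
    exact ((hrk w).comp_add_left (x w)).div_const 2
  have hsum : ∑ w, (∫ y, r y * k w y) / 2 ≤ M := by
    rw [← Finset.sum_div, ← integral_finsetSum _ fun w _ => hrk w, div_le_iff₀ two_pos]
    calc _ ≤ ∫ y, r y * (2 * M) := by
          refine integral_mono (integrable_finsetSum _ fun w _ => hrk w) (hri.mul_const _)
            fun y => ?_
          simp only [← Finset.mul_sum]
          exact mul_le_mul_of_nonneg_left (hksum y) (hr y).le
      _ = M * 2 := by rw [integral_mul_const, hr1]; ring
  have hset : ∀ w, MeasurableSet {z | dec (x w + z) = w} := fun w =>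
    (hdec.comp (measurable_const_add (x w))) (measurableSet_singleton w)
  have hpt : ∀ w z, 1 - r (x w + z) * k w (x w + z) / (2 * gaussianDensity v z)
      ≤ (Real.log (gaussianDensity v z) - Real.log (r (x w + z)))
        - ({z | dec (x w + z) = w}.indicator (fun _ => Real.log M) z - Real.log 2) := by
    intro w z
    have hg := gaussianDensity_pos hv z
    have hlogk : Real.log (k w (x w + z)) =
        {z | dec (x w + z) = w}.indicator (fun _ => Real.log M) z := by
      simp only [k, Set.indicator, Set.mem_ofPred_eq]
      split_ifs <;> simp
    have h := Real.log_le_sub_one_of_pos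
      (x := r (x w + z) * k w (x w + z) / (2 * gaussianDensity v z))
      (div_pos (mul_pos (hr _) (hk0 _ _)) (by positivity))
    rw [Real.log_div (mul_pos (hr _) (hk0 _ _)).ne' (by positivity),
      Real.log_mul (hr _).ne' (hk0 _ _).ne', Real.log_mul (by norm_num) hg.ne', hlogk] at h
    linarith
  have hw : ∀ w, 1 - (∫ y, r y * k w y) / 2 ≤
      (∫ z, (Real.log (gaussianDensity v z) - Real.log (r (x w + z))) ∂(gaussianVector v n))
       - (Real.log M * (gaussianVector v n).real {z | dec (x w + z) = w} - Real.log 2) := by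
    intro w
    have i1 : Integrable (fun z => Real.log (gaussianDensity v z) - Real.log (r (x w + z)))
      (gaussianVector v n) := (integrable_log_gaussianDensity hv n).sub (hlog w)
    have i2 : Integrable ({z | dec (x w + z) = w}.indicator (fun _ => Real.log M))
      (gaussianVector v n) := (integrable_const _).indicator (hset w)
    have i3 : Integrable
      (fun z => {z | dec (x w + z) = w}.indicator (fun _ => Real.log M) z - Real.log 2)
      (gaussianVector v n) := i2.sub (integrable_const _)
    have h := integral_mono ((integrable_const 1).sub (hintble w)) (i1.sub i3) (hpt w)
    simp only [Pi.sub_apply] at h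
    rw [integral_sub (integrable_const 1) (hintble w), integral_sub i1 i3,
      integral_sub i2 (integrable_const _), integral_indicator_const _ (hset w), hint] at h
    simp only [integral_const, probReal_univ, smul_eq_mul, one_mul] at h
    linarith
  have := Finset.sum_le_sum fun w (_ : w ∈ Finset.univ) => hw w
  rw [Finset.sum_sub_distrib, Finset.sum_sub_distrib, Finset.sum_sub_distrib,
    ← Finset.mul_sum] at this
  simp only [Finset.sum_const, Finset.card_univ, Fintype.card_fin, nsmul_eq_mul, mul_one] at this
  linarith

lemma abs_log_mixtureDensity_le [NeZero M] {v : ℝ} (hv : 0 < v) (x : Fin M → Fin n → ℂ) (w : Fin M)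
    (z : Fin n → ℂ) :
    |Real.log (mixtureDensity v x (x w + z))|
      ≤ |n * Real.log (Real.pi * v)| + Real.log M + (∑ t, ‖z t‖ ^ 2) / v := by
  have h1 := log_mixtureDensity_le hv x (x w + z)
  have h2 := infoDensity_le hv x w (x w + z)
  rw [infoDensity, log_gaussianDensity hv, Fintype.card_fin] at h2
  simp only [add_sub_cancel_left] at h2
  have h3 : 0 ≤ (∑ t, ‖z t‖ ^ 2) / v := by positivity
  have h4 : 0 ≤ Real.log M := Real.log_natCast_nonneg _
  have h5 := neg_abs_le (n * Real.log (Real.pi * v))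
  have h6 := le_abs_self (n * Real.log (Real.pi * v))
  rw [abs_le]
  constructor <;> linarith

/-- A code that is reliable at noise level `v` forces the mutual information between a uniform
message and the output at the noise level `K * v` to be at least its rate minus `log K` per
channel use. -/
lemma sum_integral_infoDensity_ge [NeZero M] {v K : ℝ} (hv : 0 < v) (hK : 1 ≤ K)
    (x : Fin M → Fin n → ℂ) {dec : (Fin n → ℂ) → Fin M} (hdec : Measurable dec) :
    Real.log M * ∑ w, (gaussianVector v n).real {z | dec (x w + z) = w}
        - M * (Real.log 2 + n * Real.log K)
      ≤ ∑ w, ∫ z, infoDensity (K * v) x w (x w + z) ∂(gaussianVector (K * v) n) := by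
  have hKv : 0 < K * v := by positivity
  -- For `K = 1`, which occurs when there is a single relay, the additional noise is degenerate; the
  -- argument covers this case too.
  have hv' : 0 ≤ (K - 1) * v := mul_nonneg (by linarith) hv.le
  have hconv : gaussianVector (K * v) n =
      (gaussianVector v n).conv (gaussianVector ((K - 1) * v) n) := by
    rw [gaussianVector_conv hv.le hv']
    congr 1
    ring
  have hqm := measurable_mixtureDensity (K * v) x
  have hq : ∀ w, Integrable (fun z => Real.log (mixtureDensity (K * v) x (x w + z)))
      (gaussianVector (K * v) n) := by
    intro w
    refine Integrable.mono' (g := fun z => |n * Real.log (Real.pi * (K * v))| + Real.log M +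
      (∑ t, ‖z t‖ ^ 2) / (K * v))
      ((integrable_const _).add ((integrable_sum_norm_sq_gaussianVector _ n).div_const _))
      (hqm.comp (measurable_const_add (x w))).log.aestronglyMeasurable
      (.of_forall fun z => abs_log_mixtureDensity_le hKv x w z)
  have hqp : ∀ w, Integrable (fun p : (Fin n → ℂ) × (Fin n → ℂ) =>
      Real.log (mixtureDensity (K * v) x (x w + (p.1 + p.2))))
      ((gaussianVector v n).prod (gaussianVector ((K - 1) * v) n)) := by
    intro w
    have h := hq w
    rw [hconv, Measure.conv] at h
    exact h.comp_measurable (f := fun p : (Fin n → ℂ) × (Fin n → ℂ) => p.1 + p.2) (by fun_prop)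
  have hqs : ∀ᵐ z' ∂(gaussianVector ((K - 1) * v) n), ∀ w,
      Integrable (fun z => Real.log (mixtureDensity (K * v) x (x w + z + z')))
        (gaussianVector v n) := by
    rw [ae_all_iff]
    intro w
    have := (hqp w).prod_left_ae
    simpa only [add_assoc] using this
  have hfub : ∀ w, ∫ z, Real.log (mixtureDensity (K * v) x (x w + z)) ∂(gaussianVector (K * v) n)
      = ∫ z', ∫ z, Real.log (mixtureDensity (K * v) x (x w + z + z')) ∂(gaussianVector v n)
        ∂(gaussianVector ((K - 1) * v) n) := by
    intro w
    have hm : Measurable fun z => Real.log (mixtureDensity (K * v) x (x w + z)) :=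
      (hqm.comp (measurable_const_add (x w))).log
    rw [hconv, Measure.conv, integral_map (by fun_prop) hm.aestronglyMeasurable,
      integral_prod_symm _ (hqp w)]
    simp only [add_assoc]
  have hfubi : ∀ w, Integrable (fun z' => ∫ z, Real.log (mixtureDensity (K * v) x (x w + z + z'))
      ∂(gaussianVector v n)) (gaussianVector ((K - 1) * v) n) := by
    intro w
    have := (hqp w).integral_prod_right
    simpa only [add_assoc] using this
  -- For a fixed value z' of the additional noise, the shifted mixture density is still a
  -- probability density, so Fano's inequality applies to it at noise level `v`. Averaging over z'
  -- then gives the bound at level `K * v`.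
  have hkey : ∀ᵐ z' ∂(gaussianVector ((K - 1) * v) n),
      ∑ w, ∫ z, Real.log (mixtureDensity (K * v) x (x w + z + z')) ∂(gaussianVector v n)
      ≤ M * (∫ z : Fin n → ℂ, Real.log (gaussianDensity v z) ∂(gaussianVector v n))
        - (Real.log M * ∑ w, (gaussianVector v n).real {z | dec (x w + z) = w}
          - M * Real.log 2) := by
    filter_upwards [hqs] with z' hz'
    have h := log_mul_sum_le_of_density hv x hdec (r := fun y => mixtureDensity (K * v) x (y + z'))
      (fun y => mixtureDensity_pos hKv x _)
      ((integrable_mixtureDensity hKv x).comp_add_right z')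
      ((integral_add_right_eq_self _ z').trans (integral_mixtureDensity hKv x)) hz'
    simp_rw [fun w => integral_sub (integrable_log_gaussianDensity hv n) (hz' w)] at h
    rw [Finset.sum_sub_distrib] at h
    simp only [Finset.sum_const, Finset.card_univ, Fintype.card_fin, nsmul_eq_mul] at h
    linarith
  have hmono := integral_mono_ae (integrable_finsetSum _ fun w _ => hfubi w)
    (integrable_const _) hkey
  rw [integral_finsetSum _ fun w _ => hfubi w] at hmono
  simp_rw [← hfub] at hmono
  simp only [integral_const, probReal_univ, smul_eq_mul, one_mul] at hmono
  have hi : ∀ w, ∫ z, infoDensity (K * v) x w (x w + z) ∂(gaussianVector (K * v) n)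
      = ∫ z : Fin n → ℂ, Real.log (gaussianDensity (K * v) z) ∂(gaussianVector (K * v) n)
        - ∫ z, Real.log (mixtureDensity (K * v) x (x w + z)) ∂(gaussianVector (K * v) n) := by
    intro w
    rw [← integral_sub (integrable_log_gaussianDensity hKv n) (hq w)]
    simp [infoDensity]
  simp_rw [hi]
  rw [Finset.sum_sub_distrib]
  simp only [Finset.sum_const, Finset.card_univ, Fintype.card_fin, nsmul_eq_mul]
  rw [integral_log_gaussianDensity hKv]
  rw [integral_log_gaussianDensity hv] at hmono
  have hl : Real.log (Real.pi * (K * v)) = Real.log (Real.pi * v) + Real.log K := by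
    rw [← Real.log_mul (by positivity) (by positivity)]
    congr 1
    ring
  rw [hl]
  linarith

end Converse

/-! ### Feinstein's greedy construction of codes. -/

section Feinstein

variable {A Y : Type*} [Fintype A] [Nonempty A] [MeasurableSpace Y]

/-- Codewords are added one at a time, each decoded on the part of its set `T` not yet taken. If no
word could be added, every word would have probability above `ε` of missing its own set or hitting a
taken one. But the average of these probabilities is at most p + k η. The last clause of the
conclusion keeps the taken region inside the sets `T` of the chosen words, as the induction needs.
-/
lemma exists_greedy_code (κ : A → Measure Y) [∀ a, IsProbabilityMeasure (κ a)] {T : A → Set Y}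
    (hT : ∀ a, MeasurableSet (T a)) {p η ε : ℝ}
    (hp : ∑ a, (κ a).real (T a)ᶜ ≤ Fintype.card A * p)
    (hη : ∀ a, ∑ a', (κ a').real (T a) ≤ Fintype.card A * η) (hη0 : 0 ≤ η)
    (k : ℕ) (hk : p + k * η ≤ ε) :
    ∃ (c : ℕ → A) (d : Y → ℕ), Measurable d ∧ (∀ j < k, (κ (c j)).real {y | d y ≠ j} ≤ ε) ∧
      ∀ y, d y < k → y ∈ T (c (d y)) := by
  classical
  have hA : (0 : ℝ) < Fintype.card A := by exact_mod_cast Fintype.card_pos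
  induction k with
  | zero => exact ⟨fun _ => Classical.arbitrary A, fun _ => 0, measurable_const, by simp, by simp⟩
  | succ k ih =>
    push_cast at hk
    obtain ⟨c, d, hd, hc, hdT⟩ := ih (by linarith)
    have hdk : MeasurableSet {y | d y < k} := measurableSet_lt hd measurable_const
    obtain ⟨x, hx⟩ : ∃ x, (κ x).real ((T x)ᶜ ∪ {y | d y < k}) ≤ ε := by
      by_contra! h
      have h1 : ∀ x, (κ x).real ((T x)ᶜ ∪ {y | d y < k})
          ≤ (κ x).real (T x)ᶜ + ∑ j ∈ Finset.range k, (κ x).real (T (c j)) := by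
        intro x
        refine (measureReal_union_le _ _).trans (add_le_add le_rfl ?_)
        refine le_trans (measureReal_mono ?_ (measure_ne_top _ _))
          (measureReal_biUnion_finset_le _ _)
        intro y hy
        simp only [Set.mem_iUnion, Finset.mem_range]
        exact ⟨d y, hy, hdT y hy⟩
      have h2 : Fintype.card A * ε < ∑ x, ((κ x).real (T x)ᶜ
          + ∑ j ∈ Finset.range k, (κ x).real (T (c j))) := by
        calc (Fintype.card A : ℝ) * ε = ∑ _x : A, ε := by simp
          _ < _ := Finset.sum_lt_sum_of_nonempty Finset.univ_nonempty
            fun x _ => (h x).trans_le (h1 x)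
      have h3 : ∑ x, ∑ j ∈ Finset.range k, (κ x).real (T (c j))
          ≤ k * (Fintype.card A * η) := by
        rw [Finset.sum_comm]
        refine (Finset.sum_le_sum fun j _ => hη (c j)).trans_eq ?_
        simp
      rw [Finset.sum_add_distrib] at h2
      have h4 : (Fintype.card A : ℝ) * (p + (k + 1) * η) ≤ Fintype.card A * ε :=
        mul_le_mul_of_nonneg_left hk hA.le
      have h5 : 0 ≤ (Fintype.card A : ℝ) * η := by positivity
      nlinarith
    -- The value `k + 1` marks an output as still free: it is not below the new number of codewords.
    refine ⟨Function.update c k x, fun y => if d y < k then d y else if y ∈ T x then k else k + 1,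
      Measurable.ite hdk hd (Measurable.ite (hT x) measurable_const measurable_const), ?_, ?_⟩
    · intro j hj
      rcases Nat.lt_succ_iff_lt_or_eq.1 hj with hj | rfl
      · rw [Function.update_of_ne hj.ne]
        refine (measureReal_mono fun y hy => ?_).trans (hc j hj)
        simp only [Set.mem_ofPred_eq] at hy ⊢
        rintro rfl
        simp [hj] at hy
      · rw [Function.update_self]
        refine (measureReal_mono fun y hy => ?_).trans hx
        simp only [Set.mem_ofPred_eq, Set.mem_union, Set.mem_compl_iff] at hy ⊢
        by_contra! hcon
        simp [hcon.1, not_lt.2 hcon.2] at hy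
    · intro y
      dsimp only
      split_ifs with h1 h2
      · intro _
        rw [Function.update_of_ne h1.ne]
        exact hdT y h1
      · intro _
        rwa [Function.update_self]
      · intro h
        exact absurd h (lt_irrefl _)

/-- **Feinstein's lemma** for a finite input alphabet with the uniform distribution. -/
lemma exists_code_of_threshold (κ : A → Measure Y) [∀ a, IsProbabilityMeasure (κ a)] {T : A → Set Y}
    (hT : ∀ a, MeasurableSet (T a)) {p η ε : ℝ}
    (hp : ∑ a, (κ a).real (T a)ᶜ ≤ Fintype.card A * p)
    (hη : ∀ a, ∑ a', (κ a').real (T a) ≤ Fintype.card A * η) (hη0 : 0 ≤ η)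
    {k : ℕ} [NeZero k] (hk : p + k * η ≤ ε) :
    ∃ (c : Fin k → A) (dec : Y → Fin k), Measurable dec ∧
      ∀ j, (κ (c j)).real {y | dec y ≠ j} ≤ ε := by
  obtain ⟨c, d, hd, hc, -⟩ := exists_greedy_code κ hT hp hη hη0 k hk
  -- Wrapping free outputs modulo `k` adds no errors: whenever `d y = j`, the wrapped value is still
  -- `j`.
  refine ⟨fun j => c j, fun y => Fin.ofNat k (d y), (measurable_of_countable (Fin.ofNat k)).comp hd,
    fun j => (measureReal_mono fun y hy => ?_).trans (hc j j.2)⟩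
  simp only [Set.mem_ofPred_eq] at hy ⊢
  intro h
  apply hy
  rw [h]
  simp

end Feinstein

/-! ### Block codes for a memoryless channel. -/

section Blocks

variable {Y : Type*} [MeasurableSpace Y] {M : ℕ}

/-- The joint law of a uniformly distributed channel input and the channel output. -/
noncomputable def jointLaw (κ : Fin M → Measure Y) : Measure (Fin M × Y) :=
  ∑ a, (M : ℝ≥0∞)⁻¹ • (κ a).map (Prod.mk a)

lemma jointLaw_apply (κ : Fin M → Measure Y) {s : Set (Fin M × Y)} (hs : MeasurableSet s) :
    jointLaw κ s = ∑ a, (M : ℝ≥0∞)⁻¹ * κ a (Prod.mk a ⁻¹' s) := by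
  simp only [jointLaw, Measure.coe_finsetSum, Measure.coe_smul, Finset.sum_apply, Pi.smul_apply,
    smul_eq_mul]
  exact Finset.sum_congr rfl fun a _ => by rw [Measure.map_apply measurable_prodMk_left hs]

instance [NeZero M] (κ : Fin M → Measure Y) [∀ a, IsProbabilityMeasure (κ a)] :
    IsProbabilityMeasure (jointLaw κ) := by
  refine ⟨?_⟩
  rw [jointLaw_apply κ .univ]
  simp [ENNReal.mul_inv_cancel (NeZero.ne (M : ℝ≥0∞)) (ENNReal.natCast_ne_top M)]

lemma integrable_jointLaw [NeZero M] (κ : Fin M → Measure Y) {f : Fin M × Y → ℝ} (hf : Measurable f)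
    (h : ∀ a, Integrable (fun y => f (a, y)) (κ a)) : Integrable f (jointLaw κ) := by
  refine integrable_finsetSum_measure.2 fun a _ => Integrable.smul_measure ?_
    (ENNReal.inv_ne_top.2 (NeZero.ne (M : ℝ≥0∞)))
  rw [integrable_map_measure hf.aestronglyMeasurable (by fun_prop)]
  exact h a

lemma integral_jointLaw [NeZero M] (κ : Fin M → Measure Y) {f : Fin M × Y → ℝ} (hf : Measurable f)
    (h : ∀ a, Integrable (fun y => f (a, y)) (κ a)) :
    ∫ p, f p ∂(jointLaw κ) = (∑ a, ∫ y, f (a, y) ∂(κ a)) / M := by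
  rw [jointLaw, integral_finsetSum_measure, Finset.sum_div]
  · refine Finset.sum_congr rfl fun a _ => ?_
    rw [integral_smul_measure, integral_map (by fun_prop) hf.aestronglyMeasurable]
    simp [div_eq_inv_mul]
  · refine fun a _ => Integrable.smul_measure ?_ (ENNReal.inv_ne_top.2 (NeZero.ne (M : ℝ≥0∞)))
    rw [integrable_map_measure hf.aestronglyMeasurable (by fun_prop)]
    exact h a

/-- Independent uniform letters form a uniform block. Hence a deviation bound for i.i.d. pairs is a
bound on an average over all blocks, as in Feinstein's lemma. -/
lemma pi_jointLaw [NeZero M] (κ : Fin M → Measure Y) [∀ a, IsProbabilityMeasure (κ a)] (L : ℕ) :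
    Measure.pi (fun _ : Fin L => jointLaw κ) = ∑ a : Fin L → Fin M, ((M : ℝ≥0∞)⁻¹) ^ L •
      (Measure.pi fun l => κ (a l)).map fun y l => (a l, y l) := by
  refine Measure.pi_eq fun s hs => ?_
  have h : ∀ a : Fin L → Fin M, Measurable fun (y : Fin L → Y) l => (a l, y l) :=
    fun a => by fun_prop
  simp only [Measure.coe_finsetSum, Measure.coe_smul, Finset.sum_apply, Pi.smul_apply,
    smul_eq_mul]
  simp_rw [fun l => jointLaw_apply κ (hs l)]
  rw [Finset.prod_univ_sum]
  refine Finset.sum_congr (by simp) fun a _ => ?_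
  rw [Measure.map_apply (h a) (.univ_pi hs), Finset.prod_mul_distrib]
  have : (fun (y : Fin L → Y) l => (a l, y l)) ⁻¹' Set.univ.pi s
      = Set.univ.pi fun l => Prod.mk (a l) ⁻¹' s l := by ext; simp
  rw [this, Measure.pi_pi]
  simp

/-- Reliable codes over blocks of a memoryless channel, at any rate below the mean of a function
`i` that is dominated by the information density for uniform inputs. -/
lemma eventually_exists_block_code [NeZero M] (κ : Fin M → Measure Y)
    [∀ a, IsProbabilityMeasure (κ a)] {i : Fin M → Y → ℝ} (him : ∀ a, Measurable (i a))
    (hi2 : ∀ a, MemLp (i a) 2 (κ a))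
    (hexp : ∀ a a', Integrable (fun y => Real.exp (i a y)) (κ a'))
    (hsum : ∀ a, ∑ a', ∫ y, Real.exp (i a y) ∂(κ a') ≤ M)
    {R : ℝ} (hR : M * R < ∑ a, ∫ y, i a y ∂(κ a)) {ε : ℝ} (hε : 0 < ε) :
    ∀ᶠ L : ℕ in atTop, ∀ k : ℕ, 0 < k → (k : ℝ) ≤ Real.exp (L * R) →
      ∃ (c : Fin k → Fin L → Fin M) (dec : (Fin L → Y) → Fin k), Measurable dec ∧
        ∀ j, (Measure.pi fun l => κ (c j l)).real {y | dec y ≠ j} ≤ ε := by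
  have hM : (0 : ℝ) < M := by exact_mod_cast Nat.pos_of_ne_zero (NeZero.ne M)
  let f : Fin M × Y → ℝ := fun p => i p.1 p.2
  have hf : Measurable f := measurable_from_prod_countable_right him
  have hi1 : ∀ a, Integrable (i a) (κ a) := fun a => (hi2 a).integrable (by norm_num)
  set I : ℝ := (∑ a, ∫ y, i a y ∂(κ a)) / M with hI
  have hfI : ∫ p, f p ∂(jointLaw κ) = I := integral_jointLaw κ hf hi1
  have hf2 : MemLp f 2 (jointLaw κ) :=
    (memLp_two_iff_integrable_sq hf.aestronglyMeasurable).2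
      (integrable_jointLaw κ (hf.pow_const 2) fun a => (hi2 a).integrable_sq)
  have hRI : R < I := by rw [hI, lt_div_iff₀ hM]; linarith
  -- Half the gap: the threshold L (I − γ) lies L γ below the mean, for Chebyshev, and L γ above L
  -- R, so that k η ≤ exp (−L γ).
  set γ : ℝ := (I - R) / 2 with hγ
  have hγ0 : 0 < γ := by rw [hγ]; linarith
  set V : ℝ := Var[f; jointLaw κ] with hV
  have hlim : Tendsto (fun L : ℕ => V / γ ^ 2 / L + Real.exp (-(L * γ))) atTop (nhds 0) := by
    have h1 : Tendsto (fun L : ℕ => V / γ ^ 2 / L) atTop (nhds 0) :=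
      tendsto_const_div_atTop_nhds_zero_nat _
    have h2 : Tendsto (fun L : ℕ => Real.exp (-(L * γ))) atTop (nhds 0) :=
      Real.tendsto_exp_neg_atTop_nhds_zero.comp
        (tendsto_natCast_atTop_atTop.atTop_mul_const hγ0)
    simpa using h1.add h2
  filter_upwards [hlim.eventually (gt_mem_nhds hε), eventually_gt_atTop 0] with L hL hL0 k hk0 hk
  have hL0' : (0 : ℝ) < L := by exact_mod_cast hL0
  have : NeZero k := ⟨hk0.ne'⟩
  let S : (Fin L → Fin M) → (Fin L → Y) → ℝ := fun a y => ∑ l, i (a l) (y l)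
  have hS : ∀ a, Measurable (S a) := fun a =>
    Finset.measurable_sum _ fun l _ => (him (a l)).comp (measurable_pi_apply l)
  let T : (Fin L → Fin M) → Set (Fin L → Y) := fun a => {y | L * (I - γ) < S a y}
  have hT : ∀ a, MeasurableSet (T a) := fun a => measurableSet_lt measurable_const (hS a)
  refine exists_code_of_threshold (fun a : Fin L → Fin M => Measure.pi fun l => κ (a l)) hT
    (p := V / γ ^ 2 / L) (η := Real.exp (-(L * (I - γ)))) ?_ ?_ (Real.exp_pos _).le ?_
  · have hcheb := meas_ge_le_variance_div_sq (μ := Measure.pi fun _ : Fin L => jointLaw κ)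
      (X := ∑ l, fun p : Fin L → Fin M × Y => f (p l))
      (memLp_finsetSum' _ fun l _ => hf2.comp_measurePreserving (measurePreserving_eval _ l))
      (mul_pos hL0' hγ0)
    rw [variance_sum_pi fun _ => hf2] at hcheb
    have hmean : ∫ p, (∑ l, fun p : Fin L → Fin M × Y => f (p l)) p
        ∂(Measure.pi fun _ : Fin L => jointLaw κ) = L * I := by
      simp_rw [Finset.sum_apply]
      rw [integral_finsetSum]
      · simp_rw [integral_comp_eval (μ := fun _ : Fin L => jointLaw κ)
          hf.aestronglyMeasurable, hfI]
        simp
      · exact fun l _ => integrable_comp_eval (hf2.integrable (by norm_num))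
    rw [hmean] at hcheb
    let B : Set (Fin L → Fin M × Y) := {p | ∑ l, f (p l) ≤ L * (I - γ)}
    have hB : MeasurableSet B := measurableSet_le
      (Finset.measurable_sum _ fun l _ => hf.comp (measurable_pi_apply l)) measurable_const
    have hBle : (Measure.pi fun _ : Fin L => jointLaw κ) B
        ≤ ENNReal.ofReal (V / γ ^ 2 / L) := by
      refine (measure_mono fun p hp => ?_).trans (hcheb.trans_eq ?_)
      · simp only [B, Set.mem_ofPred_eq, Finset.sum_apply] at hp ⊢
        rw [abs_sub_comm]
        refine le_trans ?_ (le_abs_self _)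
        linarith
      · congr 1
        simp only [Finset.sum_const, Finset.card_univ, Fintype.card_fin, nsmul_eq_mul, ← hV]
        field_simp
    have hBeq : (Measure.pi fun _ : Fin L => jointLaw κ).real B
        = (∑ a : Fin L → Fin M, (Measure.pi fun l => κ (a l)).real (T a)ᶜ) / M ^ L := by
      rw [measureReal_def, pi_jointLaw]
      simp only [Measure.coe_finsetSum, Measure.coe_smul, Finset.sum_apply, Pi.smul_apply,
        smul_eq_mul]
      rw [ENNReal.toReal_sum, Finset.sum_div]
      · refine Finset.sum_congr rfl fun a _ => ?_
        rw [Measure.map_apply (by fun_prop) hB, ENNReal.toReal_mul, div_eq_inv_mul]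
        congr 1
        · simp
        · rw [measureReal_def]
          congr 2
          ext y
          simp [B, T, S, f]
      · exact fun a _ => ENNReal.mul_ne_top
          (ENNReal.pow_ne_top (ENNReal.inv_ne_top.2 (NeZero.ne (M : ℝ≥0∞)))) (measure_ne_top _ _)
    have hV0 : 0 ≤ V := variance_nonneg _ _
    have := ENNReal.toReal_le_of_le_ofReal (by positivity) hBle
    rw [← measureReal_def, hBeq, div_le_iff₀ (by positivity)] at this
    simpa [mul_comm] using this
  · intro a
    have hint : ∀ a' : Fin L → Fin M, Integrable (fun y => Real.exp (S a y))
        (Measure.pi fun l => κ (a' l)) := fun a' => by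
      simp only [S, Real.exp_sum]
      exact Integrable.fintype_prod (f := fun l y => Real.exp (i (a l) y))
        fun l => hexp (a l) (a' l)
    -- Markov's inequality for the exponential of the information density, which factorises over the
    -- letters.
    have h1 : ∀ a' : Fin L → Fin M, (Measure.pi fun l => κ (a' l)).real (T a)
        ≤ Real.exp (-(L * (I - γ))) * ∏ l, ∫ y, Real.exp (i (a l) y) ∂(κ (a' l)) := by
      intro a'
      have h := mul_meas_ge_le_integral_of_nonneg (.of_forall fun y => (Real.exp_pos (S a y)).le)
        (hint a') (Real.exp (L * (I - γ)))
      have h2 : ∫ y, Real.exp (S a y) ∂(Measure.pi fun l => κ (a' l))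
          = ∏ l, ∫ y, Real.exp (i (a l) y) ∂(κ (a' l)) := by
        simp only [S, Real.exp_sum]
        exact integral_fintype_prod_eq_prod fun l y => Real.exp (i (a l) y)
      rw [← h2, Real.exp_neg, ← div_eq_inv_mul, le_div_iff₀' (Real.exp_pos _)]
      refine le_trans (mul_le_mul_of_nonneg_left (measureReal_mono fun y hy => ?_)
        (Real.exp_pos _).le) h
      exact Real.exp_le_exp.2 (le_of_lt hy)
    refine (Finset.sum_le_sum fun a' _ => h1 a').trans ?_
    have h3 : ∑ a' : Fin L → Fin M, ∏ l, ∫ y, Real.exp (i (a l) y) ∂(κ (a' l))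
        = ∏ l, ∑ a', ∫ y, Real.exp (i (a l) y) ∂(κ a') := by
      rw [Finset.prod_univ_sum]
      simp
    rw [← Finset.mul_sum, h3, mul_comm]
    refine mul_le_mul_of_nonneg_right ?_ (Real.exp_pos _).le
    refine (Finset.prod_le_prod (fun l _ => Finset.sum_nonneg fun a' _ =>
      integral_nonneg fun y => (Real.exp_pos _).le) fun l _ => hsum (a l)).trans_eq ?_
    simp
  · refine le_trans ?_ hL.le
    gcongr
    refine (mul_le_mul_of_nonneg_right hk (Real.exp_pos _).le).trans_eq ?_
    rw [← Real.exp_add]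
    congr 1
    rw [hγ]
    ring

end Blocks

/-! ### Block lengths that are not multiples of `n`. -/

section Padding

variable {n m : ℕ}

/-- Cut the first `m / n` blocks of length `n` out of a sequence of length `m`. -/
def toBlocks (n m : ℕ) (y : Fin m → ℂ) (l : Fin (m / n)) (j : Fin n) : ℂ :=
  y (Fin.castLE (Nat.div_mul_le_self m n) (finProdFinEquiv (l, j)))

/-- The sequence of length `m` that starts with the given `m / n` blocks of length `n`,
and is filled up with zeros. -/
def ofBlocks (n m : ℕ) (u : Fin (m / n) → Fin n → ℂ) (t : Fin m) : ℂ :=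
  if h : t.1 < m / n * n then
    u (finProdFinEquiv.symm ⟨t.1, h⟩).1 (finProdFinEquiv.symm ⟨t.1, h⟩).2
  else 0

lemma measurable_toBlocks (n m : ℕ) : Measurable (toBlocks n m) := by
  unfold toBlocks; fun_prop

lemma toBlocks_ofBlocks_add (u : Fin (m / n) → Fin n → ℂ) (z : Fin m → ℂ) :
    toBlocks n m (ofBlocks n m u + z) = u + toBlocks n m z := by
  ext l j
  have h : (Fin.castLE (Nat.div_mul_le_self m n) (finProdFinEquiv (l, j))).1 < m / n * n :=
    (finProdFinEquiv (l, j)).2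
  have h2 : (⟨(Fin.castLE (Nat.div_mul_le_self m n) (finProdFinEquiv (l, j))).1, h⟩ :
      Fin (m / n * n)) = finProdFinEquiv (l, j) := rfl
  simp only [toBlocks, Pi.add_apply, ofBlocks]
  rw [dif_pos h, h2, Equiv.symm_apply_apply]

lemma sum_norm_sq_ofBlocks (u : Fin (m / n) → Fin n → ℂ) :
    ∑ t, ‖ofBlocks n m u t‖ ^ 2 = ∑ l, ∑ j, ‖u l j‖ ^ 2 := by
  have h := Nat.div_mul_le_self m n
  have e1 : ∑ t, ‖ofBlocks n m u t‖ ^ 2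
      = ∑ s : Fin (m / n * n), ‖ofBlocks n m u (Fin.castLE h s)‖ ^ 2 := by
    symm
    refine Finset.sum_of_injOn (Fin.castLE h) (Fin.castLE_injective h).injOn (by simp) ?_ (by simp)
    intro t _ ht
    have : ¬ t.1 < m / n * n := fun hlt => ht ⟨⟨t.1, hlt⟩, by simp, by ext; simp⟩
    simp [ofBlocks, this]
  rw [e1, ← finProdFinEquiv.sum_comp, Fintype.sum_prod_type]
  refine Finset.sum_congr rfl fun l _ => Finset.sum_congr rfl fun j _ => ?_
  have := congrFun (congrFun (toBlocks_ofBlocks_add u 0) l) j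
  simp only [toBlocks, add_zero, Pi.add_apply, Pi.zero_apply] at this
  rw [this]

/-- Selecting coordinates along an injection preserves independence, and currying regroups them into
blocks. The infinite product measure serves for the currying only; on finite index types it equals
`Measure.pi`. -/
lemma gaussianVector_map_toBlocks (v : ℝ) :
    (gaussianVector v m).map (toBlocks n m)
      = Measure.pi fun _ : Fin (m / n) => gaussianVector v n := by
  let e : Fin (m / n) × Fin n → Fin m := fun p =>
    Fin.castLE (Nat.div_mul_le_self m n) (finProdFinEquiv p)
  have he : e.Injective := (Fin.castLE_injective _).comp finProdFinEquiv.injective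
  have h1 : (gaussianVector v m).map (fun y p => y (e p))
      = Measure.pi fun _ : Fin (m / n) × Fin n => complexGaussian v := by
    have hind : iIndepFun (fun (t : Fin m) (y : Fin m → ℂ) => y t) (gaussianVector v m) :=
      iIndepFun_pi (X := fun _ => id) fun _ => aemeasurable_id
    have hmeas : ∀ p, AEMeasurable (fun y : Fin m → ℂ => y (e p)) (gaussianVector v m) :=
      fun p => (measurable_pi_apply (e p)).aemeasurable
    rw [(iIndepFun_iff_map_fun_eq_pi_map hmeas).1 (hind.precomp he)]
    congr with p : 1
    exact (measurePreserving_eval (fun _ : Fin m => complexGaussian v) (e p)).map_eq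
  have h2 := Measure.infinitePi_map_curry
    (fun (_ : Fin (m / n)) (_ : Fin n) => complexGaussian v)
  simp_rw [Measure.infinitePi_eq_pi] at h2
  rw [← h1, Measure.map_map (by fun_prop) (by fun_prop)] at h2
  exact h2

end Padding

/-! ### The coding theorem for a finite constellation in Gaussian noise. -/

/-- Reliable codes of every large block length for the Gaussian channel with noise variance `v`,
at any rate below the normalised mutual information of a finite constellation of vectors, and
with no more power than the constellation has. -/
lemma eventually_exists_gaussian_code {v : ℝ} (hv : 0 < v) {n M : ℕ} [NeZero M] (hn : 0 < n)
    (x : Fin M → Fin n → ℂ) {p : ℝ} (hp : ∀ w, ∑ t, ‖x w t‖ ^ 2 ≤ n * p) (hp0 : 0 ≤ p)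
    {R : ℝ} (hR0 : 0 ≤ R)
    (hR : M * (n * R) < ∑ w, ∫ z, infoDensity v x w (x w + z) ∂(gaussianVector v n))
    {ε : ℝ} (hε : 0 < ε) :
    ∀ᶠ m : ℕ in atTop, ∃ (k : ℕ) (c : Fin k → Fin m → ℂ) (dec : (Fin m → ℂ) → Fin k),
      Measurable dec ∧ Real.exp (m * R) ≤ k ∧ (∀ j, ∑ t, ‖c j t‖ ^ 2 ≤ m * p) ∧
      ∀ j, (gaussianVector v m).real {z | dec (c j + z) ≠ j} ≤ ε := by
  have hM : (0 : ℝ) < M := by exact_mod_cast Nat.pos_of_ne_zero (NeZero.ne M)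
  set S := ∑ w, ∫ z, infoDensity v x w (x w + z) ∂(gaussianVector v n) with hS
  -- `R₁` is a rate per block of length `n`; its excess over n R pays for the incomplete last block
  -- and for rounding up the number of messages.
  obtain ⟨R₁, hR₁, hR₁S⟩ : ∃ R₁, n * R < R₁ ∧ M * R₁ < S := by
    obtain ⟨q, hq, hq'⟩ := exists_between hR
    refine ⟨q / M, ?_, ?_⟩
    · rwa [lt_div_iff₀' hM]
    · rwa [mul_div_cancel₀ _ hM.ne']
  let κ : Fin M → Measure (Fin n → ℂ) := fun w => (gaussianVector v n).map (x w + ·)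
  have hκ : ∀ w, IsProbabilityMeasure (κ w) := fun w =>
    Measure.isProbabilityMeasure_map (measurable_const_add (x w)).aemeasurable
  have him := measurable_infoDensity v x
  have hblock := eventually_exists_block_code κ (i := infoDensity v x) him
    (fun w => (memLp_map_measure_iff (him w).aestronglyMeasurable
      (measurable_const_add (x w)).aemeasurable).2 (memLp_infoDensity hv x w))
    (fun w w' => (integrable_map_measure (him w).exp.aestronglyMeasurable
      (measurable_const_add (x w')).aemeasurable).2 (integrable_exp_infoDensity hv x w w'))
    (fun w => by
      simp_rw [κ, fun w' => integral_map (measurable_const_add (x w')).aemeasurable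
        (him w).exp.aestronglyMeasurable (μ := gaussianVector v n)]
      rw [sum_integral_exp_infoDensity hv]
      simp)
    (R := R₁) (by
      simp_rw [κ, fun w => integral_map (measurable_const_add (x w)).aemeasurable
        (him w).aestronglyMeasurable (μ := gaussianVector v n)]
      exact hR₁S) hε
  have hdiv : Tendsto (fun m : ℕ => m / n) atTop atTop := Nat.tendsto_div_const_atTop hn.ne'
  have hlin : ∀ᶠ L : ℕ in atTop, Real.log 2 + n * R ≤ L * (R₁ - n * R) :=
    (tendsto_natCast_atTop_atTop.atTop_mul_const (sub_pos.2 hR₁)).eventually_ge_atTop _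
  filter_upwards [hdiv.eventually hblock, hdiv.eventually hlin] with m hm hL
  set L := m / n with hLdef
  have hmL : (m : ℝ) ≤ (L + 1) * n := by
    have := Nat.lt_div_mul_add (a := m) hn
    rw [← hLdef] at this
    have h2 : (m : ℝ) ≤ L * n + n := by exact_mod_cast this.le
    linarith
  have hLm : (L : ℝ) * n ≤ m := by exact_mod_cast Nat.div_mul_le_self m n
  have hk : (⌈Real.exp (m * R)⌉₊ : ℝ) ≤ Real.exp (L * R₁) := by
    have h1 : Real.exp (m * R) ≤ Real.exp ((L + 1) * (n * R)) := Real.exp_le_exp.2 (by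
      rw [← mul_assoc]; exact mul_le_mul_of_nonneg_right hmL hR0)
    have h2 : (1 : ℝ) ≤ Real.exp ((L + 1) * (n * R)) := Real.one_le_exp (by positivity)
    have h3 : 2 * Real.exp ((L + 1) * (n * R)) ≤ Real.exp (L * R₁) := by
      rw [← Real.exp_log two_pos, ← Real.exp_add]
      refine Real.exp_le_exp.2 ?_
      linarith
    have h4 := Nat.ceil_lt_add_one (Real.exp_pos (m * R)).le
    linarith
  obtain ⟨c, dec, hdec, herr⟩ := hm ⌈Real.exp (m * R)⌉₊ (Nat.ceil_pos.2 (Real.exp_pos _)) hk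
  refine ⟨_, fun j => ofBlocks n m fun l => x (c j l), fun y => dec (toBlocks n m y),
    hdec.comp (measurable_toBlocks n m), Nat.le_ceil _, fun j => ?_, fun j => ?_⟩
  · rw [sum_norm_sq_ofBlocks]
    calc _ ≤ ∑ _l : Fin L, n * p := Finset.sum_le_sum fun l _ => hp _
      _ = L * n * p := by simp [mul_assoc]
      _ ≤ m * p := mul_le_mul_of_nonneg_right hLm hp0
  · refine le_of_eq_of_le ?_ (herr j)
    have hset : MeasurableSet {y | dec y ≠ j} := (hdec (measurableSet_singleton j)).compl
    have hpi : (Measure.pi fun l => κ (c j l)) = (gaussianVector v m).map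
        fun z => toBlocks n m (ofBlocks n m (fun l => x (c j l)) + z) := by
      simp_rw [toBlocks_ofBlocks_add]
      have : (fun z : Fin m → ℂ => (fun l => x (c j l)) + toBlocks n m z)
        = (fun (y : Fin L → Fin n → ℂ) l => x (c j l) + y l) ∘ toBlocks n m := by
        ext; simp
      rw [this, ← Measure.map_map (by fun_prop) (measurable_toBlocks n m),
        gaussianVector_map_toBlocks,
        Measure.pi_map_pi fun l => (measurable_const_add (x (c j l))).aemeasurable]
    have hmeas : Measurable fun z => toBlocks n m (ofBlocks n m (fun l => x (c j l)) + z) :=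
      (measurable_toBlocks n m).comp (measurable_const_add _)
    rw [hpi, map_measureReal_apply hmeas hset]
    rfl

/-! ### Amplify-and-forward networks as Gaussian channels. -/

namespace GaussianDiamond

variable {N n M : ℕ} (net : GaussianDiamond N)

lemma destReceived_of_amplifyForward {c : DiamondCode N n M} {β : Fin N → ℂ}
    (hβ : ∀ i y t, c.relay i y t = β i * y t) (w : Fin M) (z : Noise N n) :
    net.destReceived c w z = (fun t => (∑ i, net.hd i * β i * net.hs i) * c.enc w t)
      + combineNoise (fun i => net.hd i * β i) n z := by
  ext t
  simp only [destReceived, relaySent, relayReceived, hβ, Pi.add_apply, combineNoise_apply]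
  rw [Finset.sum_mul, ← add_assoc, ← Finset.sum_add_distrib]
  congr 1
  exact Finset.sum_congr rfl fun i _ => by ring

lemma measureReal_error_of_amplifyForward {c : DiamondCode N n M} {β : Fin N → ℂ}
    (hβ : ∀ i y t, c.relay i y t = β i * y t) (w : Fin M) :
    (net.noiseLaw n).real {z | c.dec (net.destReceived c w z) ≠ w}
      = (gaussianVector (net.N₀ * net.W * (1 + ∑ i, ‖net.hd i * β i‖ ^ 2)) n).real
        {z | c.dec ((fun t => (∑ i, net.hd i * β i * net.hs i) * c.enc w t) + z) ≠ w} := by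
  have hset : MeasurableSet
      {z | c.dec ((fun t => (∑ i, net.hd i * β i * net.hs i) * c.enc w t) + z) ≠ w} :=
    ((c.dec_measurable.comp (measurable_const_add _)) (measurableSet_singleton w)).compl
  rw [← noiseLaw_map_combineNoise, map_measureReal_apply (by fun_prop) hset]
  simp_rw [net.destReceived_of_amplifyForward hβ]
  rfl

/-- An amplify-and-forward network is a Gaussian channel with the effective noise variance
`N₀ W (1 + ∑ |h_id β_i|²) / |∑ h_id β_i h_is|²`. -/
lemma measureReal_error_eq_gaussianVector {c : DiamondCode N n M} {β : Fin N → ℂ}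
    (hβ : ∀ i y t, c.relay i y t = β i * y t) {g : ℂ} (hg : g = ∑ i, net.hd i * β i * net.hs i)
    (hg0 : g ≠ 0) (w : Fin M) :
    (net.noiseLaw n).real {z | c.dec (net.destReceived c w z) ≠ w}
      = (gaussianVector (net.N₀ * net.W * (1 + ∑ i, ‖net.hd i * β i‖ ^ 2) / ‖g‖ ^ 2) n).real
        {z | c.dec (fun t => g * (c.enc w + z) t) ≠ w} := by
  have hσ : 0 ≤ net.N₀ * net.W := (mul_pos net.N₀_pos net.W_pos).le
  have hg' : ‖g‖ ≠ 0 := norm_ne_zero_iff.2 hg0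
  have hset : MeasurableSet {z | c.dec ((fun t => g * c.enc w t) + z) ≠ w} :=
    ((c.dec_measurable.comp (measurable_const_add _)) (measurableSet_singleton w)).compl
  have hv : net.N₀ * net.W * (1 + ∑ i, ‖net.hd i * β i‖ ^ 2)
      = ‖g‖ ^ 2 * (net.N₀ * net.W * (1 + ∑ i, ‖net.hd i * β i‖ ^ 2) / ‖g‖ ^ 2) := by
    field_simp
  rw [net.measureReal_error_of_amplifyForward hβ, ← hg, hv,
    ← gaussianVector_map_mul (div_nonneg (mul_nonneg hσ (by positivity)) (by positivity)),
    map_measureReal_apply (by fun_prop) hset, ← hv]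
  congr 1
  ext z
  simp only [Set.mem_preimage, Set.mem_ofPred_eq, Pi.add_apply, mul_add]
  rfl

/-- The exact relay power is needed in both directions: to extract a bound from the given code and
to verify the constraint for the new one. -/
lemma sum_lintegral_relaySent {c : DiamondCode N n M} {β : Fin N → ℂ}
    (hβ : ∀ i y t, c.relay i y t = β i * y t) (w : Fin M) (i : Fin N) :
    ∑ t, ∫⁻ z, ‖net.relaySent c w z i t‖ₑ ^ 2 ∂(net.noiseLaw n)
      = ENNReal.ofReal
        (‖β i‖ ^ 2 * (‖net.hs i‖ ^ 2 * ∑ t, ‖c.enc w t‖ ^ 2 + n * (net.N₀ * net.W))) := by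
  have hσ : 0 ≤ net.N₀ * net.W := (mul_pos net.N₀_pos net.W_pos).le
  have h1 : ∀ t, ∫⁻ z, ‖net.relaySent c w z i t‖ₑ ^ 2 ∂(net.noiseLaw n)
      = ENNReal.ofReal (‖β i‖ ^ 2 * (‖net.hs i * c.enc w t‖ ^ 2 + net.N₀ * net.W)) := by
    intro t
    have hlaw : MeasurePreserving (fun z : Noise N n => z.1 i t) (net.noiseLaw n)
        (complexGaussian (net.N₀ * net.W)) :=
      (measurePreserving_eval (fun _ : Fin n => complexGaussian (net.N₀ * net.W)) t).comp
        ((measurePreserving_eval (fun _ : Fin N => Measure.pi fun _ : Fin n =>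
          complexGaussian (net.N₀ * net.W)) i).comp measurePreserving_fst)
    simp only [relaySent, relayReceived, hβ, enorm_mul, mul_pow]
    rw [lintegral_const_mul _ (by fun_prop), ENNReal.ofReal_mul (by positivity),
      ← integral_norm_add_sq_complexGaussian hσ, ← hlaw.lintegral_comp (by fun_prop),
      ENNReal.ofReal_pow (norm_nonneg _), ofReal_norm]
  simp_rw [h1]
  rw [← ENNReal.ofReal_sum_of_nonneg fun t _ => by positivity, ← Finset.mul_sum,
    Finset.sum_add_distrib]
  simp only [norm_mul, mul_pow, ← Finset.mul_sum, Finset.sum_const, Finset.card_univ,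
    Fintype.card_fin, nsmul_eq_mul]
  rw [mul_left_comm (n : ℝ)]

lemma sum_measureReal_dec_eq [NeZero M] (c : DiamondCode N n M) :
    ∑ w, (net.noiseLaw n).real {z | c.dec (net.destReceived c w z) ≠ w} = M * net.errorProb c := by
  rw [errorProb, mul_div_cancel₀ _ (NeZero.ne (M : ℝ))]

/-- If the signal paths cancel, then an amplify-and-forward code with at least two messages
fails with probability at least one half. -/
lemma errorProb_of_gain_eq_zero [NeZero M] {c : DiamondCode N n M} {β : Fin N → ℂ}
    (hβ : ∀ i y t, c.relay i y t = β i * y t) (hg : ∑ i, net.hd i * β i * net.hs i = 0) :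
    M * net.errorProb c = M - 1 := by
  rw [← sum_measureReal_dec_eq]
  simp_rw [net.measureReal_error_of_amplifyForward hβ, hg]
  simp only [zero_mul]
  set μ := gaussianVector (net.N₀ * net.W * (1 + ∑ i, ‖net.hd i * β i‖ ^ 2)) n
  have hz : ∀ z : Fin n → ℂ, (fun _ => (0 : ℂ)) + z = z := fun z => zero_add z
  simp_rw [hz]
  have h : ∀ w, μ.real {z | c.dec z ≠ w} = 1 - μ.real {z | c.dec z = w} := fun w =>
    probReal_compl_eq_one_sub (c.dec_measurable (measurableSet_singleton w))
  -- The output no longer depends on the message, and the decoding regions partition the output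
  -- space.
  have h1 : ∑ w, μ.real {z | c.dec z = w} = 1 := by
    have := sum_measureReal_preimage_singleton (μ := μ) (f := c.dec) Finset.univ
      (fun w _ => c.dec_measurable (measurableSet_singleton w))
    simpa [Set.preimage] using this
  simp_rw [h]
  rw [Finset.sum_sub_distrib, h1]
  simp

lemma neZero_of_code (c : DiamondCode N n M) : NeZero M :=
  ⟨fun h => by subst h; exact (c.dec 0).elim0⟩

/-- The best single relay, with its gain suitably reduced, provides a channel whose effective noise
variance is `N ^ 2` times that of the full amplify-and-forward network. -/
lemma exists_relay_gain (β : Fin N → ℂ) {g : ℂ} (hg : g = ∑ i, net.hd i * β i * net.hs i)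
    (hg0 : g ≠ 0) :
    ∃ (i : Fin N) (b : ℂ), ‖b‖ ≤ ‖β i‖ ∧ net.hd i * b * net.hs i ≠ 0 ∧
      (1 + ‖net.hd i * b‖ ^ 2) / ‖net.hd i * b * net.hs i‖ ^ 2
        = (N : ℝ) ^ 2 * ((1 + ∑ i, ‖net.hd i * β i‖ ^ 2) / ‖g‖ ^ 2) := by
  have hN : Nonempty (Fin N) := by
    by_contra h
    rw [not_nonempty_iff] at h
    exact hg0 (by simp [hg])
  obtain ⟨i, hi⟩ := Finite.exists_max fun i => ‖net.hd i * β i * net.hs i‖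
  have hgle : ‖g‖ ≤ N * ‖net.hd i * β i * net.hs i‖ := by
    rw [hg]
    refine (norm_sum_le _ _).trans ((Finset.sum_le_sum fun j _ => hi j).trans_eq ?_)
    simp
  have hgpos : 0 < ‖g‖ := norm_pos_iff.2 hg0
  have hne : net.hd i * β i * net.hs i ≠ 0 := by
    intro h
    rw [h] at hgle
    simp at hgle
    exact hg0 hgle
  rw [norm_mul] at hgle
  set u := ‖net.hd i * β i‖ with hu
  set s := ‖net.hs i‖ with hs
  have hu0 : 0 < u := norm_pos_iff.2 (left_ne_zero_of_mul hne)
  have hs0 : 0 < s := norm_pos_iff.2 (right_ne_zero_of_mul hne)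
  set C := (N : ℝ) ^ 2 * ((1 + ∑ i, ‖net.hd i * β i‖ ^ 2) / ‖g‖ ^ 2) with hC
  have hsum : u ^ 2 ≤ ∑ i, ‖net.hd i * β i‖ ^ 2 :=
    Finset.single_le_sum (f := fun i => ‖net.hd i * β i‖ ^ 2) (fun _ _ => by positivity)
      (Finset.mem_univ i)
  have hsq : ‖g‖ ^ 2 ≤ (N * (u * s)) ^ 2 := by gcongr
  have hCs : 1 + u ^ 2 ≤ C * s ^ 2 * u ^ 2 := by
    rw [hC, mul_div_assoc', div_mul_eq_mul_div, div_mul_eq_mul_div, le_div_iff₀ (by positivity)]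
    calc (1 + u ^ 2) * ‖g‖ ^ 2
        ≤ (1 + ∑ i, ‖net.hd i * β i‖ ^ 2) * (N * (u * s)) ^ 2 := by gcongr
      _ = _ := by ring
  -- At full gain the effective noise is at most C. The reduced gain ρ must solve 1 + ρ² u² = C ρ²
  -- u² s², and this bound is what makes ρ ≤ 1. Exact equality lets a code for noise level N² v be
  -- used unchanged.
  have hD : 1 ≤ u ^ 2 * (C * s ^ 2 - 1) := by linarith
  have hD0 : 0 < u ^ 2 * (C * s ^ 2 - 1) := by linarith
  set ρ := Real.sqrt (u ^ 2 * (C * s ^ 2 - 1))⁻¹ with hρ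
  have hρ0 : 0 < ρ := Real.sqrt_pos.2 (inv_pos.2 hD0)
  have hρ1 : ρ ≤ 1 := Real.sqrt_le_one.2 (inv_le_one_of_one_le₀ hD)
  have hρ2 : ρ ^ 2 = (u ^ 2 * (C * s ^ 2 - 1))⁻¹ := Real.sq_sqrt (inv_pos.2 hD0).le
  have hnorm : ‖(ρ : ℂ)‖ = ρ := by rw [Complex.norm_real, Real.norm_of_nonneg hρ0.le]
  have hgain : ‖net.hd i * (ρ * β i)‖ = ρ * u := by
    rw [mul_left_comm, norm_mul, hnorm]
  refine ⟨i, ρ * β i, ?_, ?_, ?_⟩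
  · rw [norm_mul, hnorm]
    exact mul_le_of_le_one_left (norm_nonneg _) hρ1
  · refine norm_pos_iff.1 ?_
    rw [norm_mul (net.hd i * _), hgain]
    positivity
  · rw [norm_mul (net.hd i * _), hgain, ← hs, div_eq_iff (by positivity)]
    have h1 : ρ ^ 2 * (u ^ 2 * (C * s ^ 2 - 1)) = 1 := by rw [hρ2, inv_mul_cancel₀ hD0.ne']
    linear_combination -h1

/-! ### Transfer from the full network to a single relay. -/

/-- The amplify-and-forward code with given gains. -/
noncomputable def amplifyForwardCode (β : Fin N → ℂ) (enc : Fin M → Fin n → ℂ)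
    {dec : (Fin n → ℂ) → Fin M} (hdec : Measurable dec) : DiamondCode N n M where
  enc := enc
  relay i y t := β i * y t
  relay_measurable i := by fun_prop
  relay_causal i t y y' h := by rw [h t le_rfl]
  dec := dec
  dec_measurable := hdec

lemma achievable_of_nonpos (Γ : Finset (Fin N)) {R : ℝ} (hR : R ≤ 0) :
    net.Achievable (fun c => c.UsesOnly Γ) R := by
  intro ε hε
  refine .of_forall fun n => ⟨1, amplifyForwardCode 0 0 (dec := fun _ => 0) measurable_const,
    ?_, ?_, ?_, ?_⟩
  · simpa using Real.rpow_le_one_of_one_le_of_nonpos one_le_two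
      (mul_nonpos_of_nonneg_of_nonpos n.cast_nonneg hR)
  · intro i _ y t
    simp [amplifyForwardCode]
  · intro w
    refine ⟨?_, fun i => ?_⟩
    · simpa [amplifyForwardCode] using mul_nonneg n.cast_nonneg net.P_pos.le
    · rw [net.sum_lintegral_relaySent (β := 0) (fun _ _ _ => rfl)]
      simp
  · have h : ∀ w v : Fin 1, ¬ w ≠ v := fun w v h => h (Subsingleton.elim _ _)
    simp [errorProb, h, hε.le]

lemma achievable_of_achievable_amplifyForward {R : ℝ}
    (hR : net.Achievable (fun c => c.IsAmplifyForward) R) {δ : ℝ} (hδ : 0 < δ)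
    (hpos : 0 < R - 2 * Real.logb 2 N - δ) :
    ∃ i, net.Achievable (fun c => c.UsesOnly {i}) (R - 2 * Real.logb 2 N - δ) := by
  have hσ : 0 < net.N₀ * net.W := mul_pos net.N₀_pos net.W_pos
  have hlogN : 0 ≤ Real.logb 2 N := by
    rw [Real.logb]
    exact div_nonneg (Real.log_natCast_nonneg _) (Real.log_nonneg one_le_two)
  have hR0 : 0 < R := by linarith
  -- Fano's inequality loses ε₀ R plus 1 / n bits per channel use. This choice gives ε₀ R ≤ δ / 4,
  -- and n δ ≥ 2 gives 1 / n ≤ δ / 2, so the loss stays below δ.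
  set ε₀ : ℝ := δ / (4 * (R + δ)) with hε₀
  have hε₀0 : 0 < ε₀ := by positivity
  have hε₀1 : ε₀ ≤ 1 / 4 := by
    rw [hε₀, div_le_iff₀ (by positivity)]; linarith
  have hε₀R : ε₀ * R ≤ δ / 4 := by
    rw [hε₀, div_mul_eq_mul_div, div_le_iff₀ (by positivity)]
    nlinarith
  have hlarge : ∀ᶠ n : ℕ in atTop, 2 ≤ n * δ :=
    (tendsto_natCast_atTop_atTop.atTop_mul_const hδ).eventually_ge_atTop _
  obtain ⟨n, ⟨M, c, hMR, ⟨β, hβ⟩, hpow, herr⟩, hnδ, hn0⟩ :=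
    ((hR ε₀ hε₀0).and (hlarge.and (eventually_gt_atTop 0))).exists
  have : NeZero M := neZero_of_code c
  have hM : (0 : ℝ) < M := by exact_mod_cast Nat.pos_of_ne_zero (NeZero.ne M)
  have hn : (0 : ℝ) < n := by exact_mod_cast hn0
  have hM1 : (1 : ℝ) < M :=
    (Real.one_lt_rpow one_lt_two (mul_pos hn hR0)).trans_le hMR
  obtain ⟨g, hg⟩ : ∃ g : ℂ, g = ∑ i, net.hd i * β i * net.hs i := ⟨_, rfl⟩
  -- With zero gain the error probability would be at least 1 / 2, since M ≥ 2, but ε₀ ≤ 1 / 4.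
  have hg0 : g ≠ 0 := by
    rintro rfl
    have h1 := net.errorProb_of_gain_eq_zero hβ hg.symm
    have h2 : (2 : ℝ) ≤ M := by
      have : 1 < M := by exact_mod_cast hM1
      exact_mod_cast this
    nlinarith
  obtain ⟨i, b, hbβ, hgi, hCi⟩ := net.exists_relay_gain β hg hg0
  have hN1 : (1 : ℝ) ≤ (N : ℝ) ^ 2 := by
    have : 1 ≤ N := i.pos
    exact one_le_pow₀ (by exact_mod_cast this)
  set v := net.N₀ * net.W * (1 + ∑ i, ‖net.hd i * β i‖ ^ 2) / ‖g‖ ^ 2 with hv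
  have hgn : 0 < ‖g‖ := norm_pos_iff.2 hg0
  have hv0 : 0 < v := by positivity
  have hdec : Measurable fun y : Fin n → ℂ => c.dec fun t => g * y t :=
    c.dec_measurable.comp (by fun_prop)
  have hinfo := sum_integral_infoDensity_ge hv0 hN1 c.enc hdec
  have hcorrect : M * (1 - ε₀) ≤ ∑ w, (gaussianVector v n).real
      {z | c.dec (fun t => g * (c.enc w + z) t) = w} := by
    have h1 : ∀ w, (gaussianVector v n).real {z | c.dec (fun t => g * (c.enc w + z) t) = w}
        = 1 - (net.noiseLaw n).real {z | c.dec (net.destReceived c w z) ≠ w} := by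
      intro w
      rw [net.measureReal_error_eq_gaussianVector hβ hg hg0]
      have hset : MeasurableSet {z | c.dec (fun t => g * (c.enc w + z) t) = w} :=
        (hdec.comp (measurable_const_add (c.enc w))) (measurableSet_singleton w)
      have := probReal_compl_eq_one_sub (μ := gaussianVector v n) hset
      have h2 : {z | c.dec (fun t => g * (c.enc w + z) t) = w}ᶜ
          = {z | c.dec (fun t => g * (c.enc w + z) t) ≠ w} := rfl
      rw [h2] at this
      linarith
    simp_rw [h1]
    rw [Finset.sum_sub_distrib, sum_measureReal_dec_eq]
    simp only [Finset.sum_const, Finset.card_univ, Fintype.card_fin, nsmul_eq_mul, mul_one]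
    nlinarith
  have hlog2 : 0 < Real.log 2 := Real.log_pos one_lt_two
  have hlogM : n * R * Real.log 2 ≤ Real.log M := by
    rw [← Real.log_rpow two_pos]
    exact Real.log_le_log (by positivity) hMR
  have hlogM0 : 0 ≤ Real.log M := Real.log_natCast_nonneg _
  have hrate : M * (n * ((R - 2 * Real.logb 2 N - δ) * Real.log 2))
      < ∑ w, ∫ z, infoDensity ((N : ℝ) ^ 2 * v) c.enc w (c.enc w + z)
        ∂(gaussianVector ((N : ℝ) ^ 2 * v) n) := by
    refine lt_of_lt_of_le ?_ hinfo
    have h1 : Real.log M * (M * (1 - ε₀)) ≤ Real.log M * ∑ w, (gaussianVector v n).real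
      {z | c.dec (fun t => g * (c.enc w + z) t) = w} := mul_le_mul_of_nonneg_left hcorrect hlogM0
    have h2 : n * R * Real.log 2 * (M * (1 - ε₀)) ≤ Real.log M * (M * (1 - ε₀)) :=
      mul_le_mul_of_nonneg_right hlogM (mul_nonneg hM.le (by linarith))
    have h3 : Real.logb 2 N * Real.log 2 = Real.log N := by
      rw [Real.logb, div_mul_cancel₀ _ hlog2.ne']
    have h4 : Real.log ((N : ℝ) ^ 2) = 2 * Real.log N := by rw [Real.log_pow]; norm_num
    have h5 : n * (ε₀ * R) + 1 < n * δ := by nlinarith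
    have h6 : M * Real.log 2 * (n * (ε₀ * R) + 1) < M * Real.log 2 * (n * δ) := by gcongr
    rw [h4, ← h3]
    linarith
  obtain ⟨w₀, hw₀⟩ := Finite.exists_max fun w => ∑ t, ‖c.enc w t‖ ^ 2
  -- The new code may repeat the most energetic codeword in every block, so its power is measured by
  -- that codeword. The old relay power constraint for this message then bounds the power of the new
  -- relay.
  set p := (∑ t, ‖c.enc w₀ t‖ ^ 2) / n with hp
  have hnp : n * p = ∑ t, ‖c.enc w₀ t‖ ^ 2 := mul_div_cancel₀ _ hn.ne'
  have hp0 : 0 ≤ p := by positivity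
  have hpP : p ≤ net.P := by
    have := (hpow w₀).1
    rw [← hnp] at this
    exact le_of_mul_le_mul_left this hn
  have hbP : ‖b‖ ^ 2 * (‖net.hs i‖ ^ 2 * p + net.N₀ * net.W) ≤ net.P := by
    have h := (hpow w₀).2 i
    rw [net.sum_lintegral_relaySent hβ, ENNReal.ofReal_le_ofReal_iff
      (mul_nonneg hn.le net.P_pos.le), ← hnp] at h
    have h2 : ‖b‖ ^ 2 * (‖net.hs i‖ ^ 2 * p + net.N₀ * net.W)
        ≤ ‖β i‖ ^ 2 * (‖net.hs i‖ ^ 2 * p + net.N₀ * net.W) := by gcongr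
    refine h2.trans (le_of_mul_le_mul_left ?_ hn)
    linarith
  refine ⟨i, fun ε hε => ?_⟩
  have hKv : 0 < (N : ℝ) ^ 2 * v := by positivity
  filter_upwards [eventually_exists_gaussian_code hKv hn0 c.enc (p := p)
    (fun w => by rw [hnp]; exact hw₀ w) hp0 (mul_pos hpos hlog2).le hrate hε] with m hm
  obtain ⟨k, x, dec, hdecm, hk, hxp, hxerr⟩ := hm
  obtain ⟨g', hg'⟩ : ∃ g' : ℂ, g' = net.hd i * b * net.hs i := ⟨_, rfl⟩
  -- The destination divides by the gain g' of the single path before decoding.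
  have hdec' : Measurable fun y : Fin m → ℂ => dec fun t => g'⁻¹ * y t :=
    hdecm.comp (by fun_prop)
  let c' : DiamondCode N m k := amplifyForwardCode (Pi.single i b) x hdec'
  have hc' : ∀ j y t, c'.relay j y t = (Pi.single i b : Fin N → ℂ) j * y t := fun _ _ _ => rfl
  have hsingle : ∀ j, net.hd j * (Pi.single i b : Fin N → ℂ) j
      = (Pi.single i (net.hd i * b) : Fin N → ℂ) j := by
    intro j
    rcases eq_or_ne j i with rfl | h
    · simp
    · simp [h]
  have hgsum : g' = ∑ j, net.hd j * (Pi.single i b : Fin N → ℂ) j * net.hs j := by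
    rw [Finset.sum_eq_single i (fun j _ hj => by simp [hj]) (by simp)]
    simp [hg']
  have hnoise : ∑ j, ‖net.hd j * (Pi.single i b : Fin N → ℂ) j‖ ^ 2 = ‖net.hd i * b‖ ^ 2 := by
    rw [Finset.sum_eq_single i (fun j _ hj => by simp [hj]) (by simp)]
    simp
  have hg'0 : g' ≠ 0 := hg' ▸ hgi
  have hveq : net.N₀ * net.W * (1 + ‖net.hd i * b‖ ^ 2) / ‖g'‖ ^ 2 = (N : ℝ) ^ 2 * v := by
    rw [mul_div_assoc, hg', hCi, hv]
    ring
  have hkne : NeZero k := neZero_of_code c'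
  refine ⟨k, c', ?_, ?_, ?_, ?_⟩
  · refine le_trans (le_of_eq ?_) hk
    rw [Real.rpow_def_of_pos two_pos]
    congr 1
    ring
  · intro j hj y t
    rw [hc', Pi.single_eq_of_ne (by simpa using hj), zero_mul]
  · intro w
    refine ⟨(hxp w).trans (by gcongr), fun j => ?_⟩
    rw [net.sum_lintegral_relaySent hc']
    refine ENNReal.ofReal_le_ofReal ?_
    rcases eq_or_ne j i with rfl | h
    · rw [Pi.single_eq_same]
      have h1 : ‖net.hs j‖ ^ 2 * ∑ t, ‖c'.enc w t‖ ^ 2 ≤ ‖net.hs j‖ ^ 2 * (m * p) :=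
        mul_le_mul_of_nonneg_left (hxp w) (by positivity)
      calc ‖b‖ ^ 2 * (‖net.hs j‖ ^ 2 * ∑ t, ‖c'.enc w t‖ ^ 2 + m * (net.N₀ * net.W))
          ≤ ‖b‖ ^ 2 * (‖net.hs j‖ ^ 2 * (m * p) + m * (net.N₀ * net.W)) := by gcongr
        _ = m * (‖b‖ ^ 2 * (‖net.hs j‖ ^ 2 * p + net.N₀ * net.W)) := by ring
        _ ≤ m * net.P := by gcongr
    · rw [Pi.single_eq_of_ne h]
      simpa using mul_nonneg m.cast_nonneg net.P_pos.le
  · have herr' : ∀ w, (net.noiseLaw m).real {z | c'.dec (net.destReceived c' w z) ≠ w} ≤ ε := by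
      intro w
      rw [net.measureReal_error_eq_gaussianVector hc' hgsum hg'0, hnoise, hveq]
      refine le_of_eq_of_le ?_ (hxerr w)
      congr 1
      ext z
      simp only [c', amplifyForwardCode, inv_mul_cancel_left₀ hg'0]
    rw [errorProb, div_le_iff₀ (by exact_mod_cast Nat.pos_of_ne_zero (NeZero.ne k))]
    refine (Finset.sum_le_sum fun w _ => herr' w).trans_eq ?_
    simp [mul_comm]

end GaussianDiamond

theorem theorem2 (N : ℕ) (hN : 1 ≤ N) (net : GaussianDiamond N) :
    net.rateAF ≤ net.capacityUsing 1 + ((2 * Real.logb 2 N : ℝ) : EReal) := by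
  have hmem : ∀ (i : Fin N) (R : ℝ), net.Achievable (fun c => c.UsesOnly {i}) R →
      (R : EReal) ≤ net.capacityUsing 1 := fun i R hR =>
    le_sSup ⟨R, rfl, {i}, Finset.card_singleton i, hR⟩
  refine sSup_le ?_
  rintro _ ⟨R, rfl, hR⟩
  -- A positive target rate is transferred to the best relay. For a nonpositive one a single message
  -- suffices, with any relay, and `hN` ensures that there is one.
  have hδ : ∀ δ : ℝ, 0 < δ → ((R - 2 * Real.logb 2 N - δ : ℝ) : EReal) ≤ net.capacityUsing 1 := by
    intro δ hδ
    rcases lt_or_ge 0 (R - 2 * Real.logb 2 N - δ) with h | h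
    · obtain ⟨i, hi⟩ := net.achievable_of_achievable_amplifyForward hR hδ h
      exact hmem i _ hi
    · exact hmem ⟨0, hN⟩ _ (net.achievable_of_nonpos _ h)
  have hle : ((R - 2 * Real.logb 2 N : ℝ) : EReal) ≤ net.capacityUsing 1 := by
    refine EReal.ge_of_forall_gt_iff_ge.1 fun z hz => ?_
    have h := hδ (R - 2 * Real.logb 2 N - z) (sub_pos.2 (EReal.coe_lt_coe_iff.1 hz))
    rwa [sub_sub_cancel] at h
  calc (R : EReal) = ((R - 2 * Real.logb 2 N : ℝ) : EReal) + ((2 * Real.logb 2 N : ℝ) : EReal) := by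
        rw [← EReal.coe_add, sub_add_cancel]
    _ ≤ _ := by gcongr
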